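/- Let $A$ be a separable unital $C^*$-algebra, let $P\subset A$ be a $C^*$-subalgebra containing the unit of $A$ (so $P$ is separable as well), and let $E\colon A\to P$ be a conditional expectation of $A$ onto $P$. Suppose that $E$ has finite index: there are $u_1,v_1,\dots,u_n,v_n\in A$ (a quasi-basis) such that $a=\sum_{i}u_iE(v_ia)=\sum_{i}E(au_i)v_i$ for all $a\in A$. Then the element $\mathrm{Index}\,E=\sum_i u_iv_i\in A$ does not depend on the choice of the quasi-basis. Put $A^\infty=\ell^\infty(\mathbb N,A)/c_0(A)$, where $c_0(A)$ is the ideal of sequences with $\lim_n\|a_n\|=0$, view $A$ as the subalgebra of $A^\infty$ of classes of constant sequences, let $A_\infty=A^\infty\cap A'$, and let $E^\infty$ be the map on $A^\infty$ induced by applying $E$ termwise. Suppose that $E$ has the Rohlin property: there is a projection $e\in A_\infty$ with $E^\infty(e)=(\mathrm{Index}\,E)^{-1}$ such that the map $A\ni x\mapsto xe$ is injective. If $A$ is an AF algebra, i.e. the closure of the union of an increasing sequence of finite-dimensional $C^*$-subalgebras, then $P$ is also an AF algebra. -/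

import Mathlib

open Filter Topology
open scoped BoundedContinuousFunction

noncomputable section

namespace RohlinInclusion

/-! ### Conditional expectations and the Watatani index -/

section Index

variable {A : Type*} [CStarAlgebra A]

/-- `E` is a conditional expectation from the unital C⋆-algebra `A` onto its unital
C⋆-subalgebra `P`: a bounded linear, positive, `P`-bimodular projection of `A` onto `P`.
It is written as a map `A → A` with values in `P`. -/
structure IsConditionalExpectation (P : StarSubalgebra ℂ A) (E : A →L[ℂ] A) : Prop where
  map_mem : ∀ a, E a ∈ P
  map_of_mem : ∀ p ∈ P, E p = p
  map_mul_left : ∀ p ∈ P, ∀ a, E (p * a) = p * E a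
  map_mul_right : ∀ a, ∀ p ∈ P, E (a * p) = E a * p
  map_nonneg : ∀ a, ∃ b ∈ P, E (star a * a) = star b * b

/-- `{(u i, v i)}` is a quasi-basis for `E`. -/
def IsQuasiBasis (E : A →L[ℂ] A) {n : ℕ} (u v : Fin n → A) : Prop :=
  ∀ a : A, a = ∑ i, u i * E (v i * a) ∧ a = ∑ i, E (a * u i) * v i

/-- `E` has a finite index, that is, it has a quasi-basis. -/
def HasFiniteIndex (E : A →L[ℂ] A) : Prop :=
  ∃ (n : ℕ) (u v : Fin n → A), IsQuasiBasis E u v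

open Classical in
/-- The Watatani index `∑ i, u i * v i`, computed from any quasi-basis
(see `watataniIndex_eq`); the value `0` when there is no quasi-basis is a dummy. -/
def watataniIndex (E : A →L[ℂ] A) : A :=
  if h : HasFiniteIndex E then
    ∑ i, h.choose_spec.choose i * h.choose_spec.choose_spec.choose i
  else 0

theorem IsQuasiBasis.sum_eq_sum {E : A →L[ℂ] A} {m n : ℕ} {u v : Fin m → A} {u' v' : Fin n → A}
    (h : IsQuasiBasis E u v) (h' : IsQuasiBasis E u' v') :
    ∑ i, u i * v i = ∑ j, u' j * v' j := by
  calc ∑ i, u i * v i = ∑ i, u i * ∑ j, E (v i * u' j) * v' j :=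
        Finset.sum_congr rfl fun i _ => by rw [← (h' (v i)).2]
    _ = ∑ j, (∑ i, u i * E (v i * u' j)) * v' j := by
        simp only [Finset.mul_sum, Finset.sum_mul, mul_assoc]
        exact Finset.sum_comm
    _ = ∑ j, u' j * v' j :=
        Finset.sum_congr rfl fun j _ => by rw [← (h (u' j)).1]

/-- The index does not depend on the choice of the quasi-basis. -/
theorem watataniIndex_eq {E : A →L[ℂ] A} {n : ℕ} {u v : Fin n → A} (h : IsQuasiBasis E u v) :
    watataniIndex E = ∑ i, u i * v i := by
  have hf : HasFiniteIndex E := ⟨n, u, v, h⟩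
  rw [watataniIndex, dif_pos hf]
  exact IsQuasiBasis.sum_eq_sum hf.choose_spec.choose_spec.choose_spec h

end Index

/-! ### The sequence algebra `ℓ^∞(ℕ, A) / c₀(A)` -/

section SequenceAlgebra

variable (A : Type*) [CStarAlgebra A]

/-- The ideal `c₀(A)` of `ℓ^∞(ℕ, A)`. (Every sequence is continuous on the discrete space `ℕ`,
so `ℕ →ᵇ A` is the algebra of all bounded sequences in `A`.) -/
def cZero : Ideal (ℕ →ᵇ A) where
  carrier := {f | Tendsto (fun n => ‖f n‖) atTop (𝓝 0)}
  zero_mem' := by simp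
  add_mem' := by
    intro f g hf hg
    refine squeeze_zero (fun n => norm_nonneg _) (fun n => norm_add_le (f n) (g n)) ?_
    simpa using Tendsto.add hf hg
  smul_mem' := by
    intro c f hf
    refine squeeze_zero (g := fun n => ‖c‖ * ‖f n‖) (fun n => norm_nonneg _) (fun n => ?_) ?_
    · exact (norm_mul_le (c n) (f n)).trans
        (mul_le_mul_of_nonneg_right (c.norm_coe_le_norm n) (norm_nonneg _))
    · simpa using Tendsto.const_mul ‖c‖ hf

theorem mem_cZero {f : ℕ →ᵇ A} : f ∈ cZero A ↔ Tendsto (fun n => ‖f n‖) atTop (𝓝 0) := Iff.rfl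

instance : (cZero A).IsTwoSided where
  mul_mem_of_left := by
    intro f c hf
    rw [mem_cZero] at hf ⊢
    refine squeeze_zero (g := fun n => ‖f n‖ * ‖c‖) (fun n => norm_nonneg _) (fun n => ?_) ?_
    · exact (norm_mul_le (f n) (c n)).trans
        (mul_le_mul_of_nonneg_left (c.norm_coe_le_norm n) (norm_nonneg _))
    · simpa using Tendsto.mul_const ‖c‖ hf

/-- The algebra `A^∞ = ℓ^∞(ℕ, A) / c₀(A)`. -/
abbrev SeqAlgebra : Type _ := (ℕ →ᵇ A) ⧸ cZero A

variable {A}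

theorem star_mem_cZero {f : ℕ →ᵇ A} (hf : f ∈ cZero A) : star f ∈ cZero A := by
  rw [mem_cZero] at hf ⊢
  simpa using hf

/-- The involution of `A^∞`, induced by the pointwise involution of sequences. -/
instance : StarRing (SeqAlgebra A) where
  star := QuotientAddGroup.map _ _ (starAddEquiv : (ℕ →ᵇ A) ≃+ (ℕ →ᵇ A)).toAddMonoidHom
    (fun _ hf => star_mem_cZero hf)
  star_involutive := by
    intro x
    obtain ⟨f, rfl⟩ := Ideal.Quotient.mk_surjective x
    exact congrArg (Ideal.Quotient.mk (cZero A)) (star_star f)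
  star_mul := by
    intro x y
    obtain ⟨f, rfl⟩ := Ideal.Quotient.mk_surjective x
    obtain ⟨g, rfl⟩ := Ideal.Quotient.mk_surjective y
    exact congrArg (Ideal.Quotient.mk (cZero A)) (star_mul f g)
  star_add := by
    intro x y
    obtain ⟨f, rfl⟩ := Ideal.Quotient.mk_surjective x
    obtain ⟨g, rfl⟩ := Ideal.Quotient.mk_surjective y
    exact congrArg (Ideal.Quotient.mk (cZero A)) (star_add f g)

theorem star_mk (f : ℕ →ᵇ A) :
    star (Ideal.Quotient.mk (cZero A) f) = Ideal.Quotient.mk (cZero A) (star f) := rfl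

/-- The embedding of `A` in `A^∞` by (classes of) constant sequences. -/
def constEmb (a : A) : SeqAlgebra A :=
  Ideal.Quotient.mk (cZero A) (BoundedContinuousFunction.const ℕ a)

/-- The map `E^∞` on `A^∞` induced by applying `E` termwise to sequences. Its values are classes
of sequences in the range of `E`, so for a conditional expectation onto `P` it takes values in
`P^∞`, regarded as a subalgebra of `A^∞`. -/
def inducedMap (E : A →L[ℂ] A) : SeqAlgebra A →+ SeqAlgebra A :=
  QuotientAddGroup.map _ _ (E.compLeftContinuousBounded ℕ : (ℕ →ᵇ A) →L[ℂ] (ℕ →ᵇ A)) (by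
    intro f hf
    refine squeeze_zero (g := fun n => ‖E‖ * ‖f n‖) (fun n => norm_nonneg _)
      (fun n => E.le_opNorm (f n)) ?_
    simpa using Tendsto.const_mul ‖E‖ ((mem_cZero A).1 hf))

theorem inducedMap_mk (E : A →L[ℂ] A) (f : ℕ →ᵇ A) :
    inducedMap E (Ideal.Quotient.mk (cZero A) f) =
      Ideal.Quotient.mk (cZero A) (E.compLeftContinuousBounded ℕ f) := rfl

/-- The central sequence algebra `A_∞ = A^∞ ∩ A'`, as a subset of `A^∞`. -/
def centralSeq (A : Type*) [CStarAlgebra A] : Set (SeqAlgebra A) :=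
  {x | ∀ a : A, constEmb a * x = x * constEmb a}

/-- `e` is a Rohlin projection for `E`: a projection in `A_∞` such that
`E^∞(e) = (Index E)⁻¹` and `a ↦ a e` is injective on `A`. -/
structure IsRohlinProjection (E : A →L[ℂ] A) (e : SeqAlgebra A) : Prop where
  isStarProjection : IsStarProjection e
  mem_centralSeq : e ∈ centralSeq A
  inducedMap_eq : ∃ w : Aˣ, (w : A) = watataniIndex E ∧
    inducedMap E e = constEmb ((w⁻¹ : Aˣ) : A)
  injective : Function.Injective fun a : A => constEmb a * e

/-- The Rohlin property of a map with finite index. -/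
def HasRohlinProperty (E : A →L[ℂ] A) : Prop :=
  HasFiniteIndex E ∧ ∃ e : SeqAlgebra A, IsRohlinProjection E e

end SequenceAlgebra

/-- A unital C⋆-algebra is AF if it is the closure of the union of an increasing sequence of
finite-dimensional C⋆-subalgebras. (The subalgebras contain the unit of the algebra, which is no
restriction, since one may add the scalars to each of them; finite-dimensional ⋆-subalgebras are
automatically closed.) -/
def IsAF (B : Type*) [CStarAlgebra B] : Prop :=
  ∃ F : ℕ → StarSubalgebra ℂ B, Monotone F ∧ (∀ n, FiniteDimensional ℂ (F n)) ∧
    Dense (⋃ n, (F n : Set B))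

end RohlinInclusion

end

/-! The Rohlin projection yields an approximate retraction of A onto P. Let W = Index E, which is
central in A, and put B(a) = W E^∞(ea). The key identity ea = eB(a) (`projection_mul_const_eq`) and
the centrality of e make B a unital ⋆-homomorphism from A to P^∞, and E^∞(e) = W⁻¹ makes it the
identity on P. Lifting e to a bounded sequence f gives maps a ↦ E(W f_n a) from A to P that are
asymptotically ⋆-homomorphic and asymptotically fix P
(`HasRohlinProperty.exists_asymptotic_retraction`).

A finite subset of P lies near a finite-dimensional G ⊂ A. For large n the n-th map is almost a
⋆-homomorphism on G, hence near a genuine one (`exists_starAlgHom_near`), whose range is a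
finite-dimensional subalgebra of P near the given set. So P is locally AF, and separability upgrades
this to AF as in Bratteli's theorem (`IsLocallyAF.isAF`).

Both perturbation arguments use a separability idempotent of G (`exists_diagonal`) instead of matrix
units: it drives a Newton iteration towards homomorphisms and averages out intertwiners. The key
identity is a positivity argument with a quasi-basis of the form (w_i, w_i⋆). -/

namespace RohlinInclusion

/-! ### Separability idempotents of finite-dimensional C⋆-algebras -/

section FiniteDimensional

-- The trace is the sum of the eigenvalues, so nonnegative eigenvalues with sum zero all vanish.
open scoped ComplexOrder in
theorem isNilpotent_of_trace_eq_zero_of_spectrum_nonneg {V : Type*} [AddCommGroup V]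
    [Module ℂ V] [FiniteDimensional ℂ V] (f : Module.End ℂ V)
    (hf : ∀ z ∈ spectrum ℂ f, 0 ≤ z) (ht : LinearMap.trace ℂ V f = 0) : IsNilpotent f := by
  have hs : f.charpoly.Splits := IsAlgClosed.splits _
  rw [Module.End.trace_eq_sum_roots_charpoly_of_splits hs] at ht
  have hnn : ∀ z ∈ f.charpoly.roots, 0 ≤ z := fun z hz =>
    hf z (Module.End.hasEigenvalue_iff_isRoot_charpoly f z |>.2
      (Polynomial.isRoot_of_mem_roots hz)).mem_spectrum
  have h0 : ∀ z ∈ f.charpoly.roots, z = 0 :=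
    fun z hz => Multiset.all_zero_of_le_zero_le_of_sum_eq_zero hnn ht z hz
  rw [LinearMap.isNilpotent_iff_charpoly]
  have h1 := hs.eq_prod_roots_of_monic f.charpoly_monic
  rw [Multiset.eq_replicate_of_mem h0] at h1
  have hc : Multiset.card f.charpoly.roots = Module.finrank ℂ V := by
    rw [← LinearMap.charpoly_natDegree f, hs.natDegree_eq_card_roots]
  simpa [hc] using h1

theorem _root_.IsSelfAdjoint.eq_zero_of_isNilpotent {B : Type*} [CStarAlgebra B] {x : B}
    (hx : IsSelfAdjoint x) (h : IsNilpotent x) : x = 0 := by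
  obtain ⟨n, hn⟩ := h
  have h1 : x ^ 2 ^ n = 0 := pow_eq_zero_of_le Nat.lt_two_pow_self.le hn
  have h2 := hx.nnnorm_pow_two_pow n
  rw [h1, nnnorm_zero] at h2
  exact nnnorm_eq_zero.1 (eq_zero_of_pow_eq_zero h2.symm)

variable {F : Type*} [CStarAlgebra F]

open scoped ComplexOrder in
theorem nonneg_of_mem_spectrum_star_mul_self (x : F) (z : ℂ)
    (hz : z ∈ spectrum ℂ (star x * x)) : 0 ≤ z := by
  have hsa := IsSelfAdjoint.star_mul_self x
  rw [← hsa.spectrumRestricts.algebraMap_image] at hz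
  obtain ⟨r, hr, rfl⟩ := hz
  have := spectrum_star_mul_self_nonneg r hr
  simpa using this

variable (F) in
/-- The trace of the left regular representation. -/
noncomputable def leftTrace : F →ₗ[ℂ] ℂ := LinearMap.trace ℂ F ∘ₗ (Algebra.lmul ℂ F).toLinearMap

theorem leftTrace_apply (x : F) :
    leftTrace F x = LinearMap.trace ℂ F (Algebra.lmul ℂ F x) := rfl

theorem leftTrace_mul_comm (x y : F) : leftTrace F (x * y) = leftTrace F (y * x) := by
  simp only [leftTrace_apply, map_mul]
  exact LinearMap.trace_mul_comm ℂ _ _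

variable (F) in
/-- The trace form of the left regular representation. -/
noncomputable def leftTraceForm : LinearMap.BilinForm ℂ F :=
  (LinearMap.mul ℂ F).compr₂ (leftTrace F)

theorem leftTraceForm_apply (x y : F) : leftTraceForm F x y = leftTrace F (x * y) := rfl

variable (F) in
theorem leftTraceForm_isSymm : (leftTraceForm F).IsSymm :=
  ⟨fun x y => leftTrace_mul_comm x y⟩

variable [FiniteDimensional ℂ F]

theorem eq_zero_of_leftTrace_star_mul_self (x : F)
    (h : leftTrace F (star x * x) = 0) : x = 0 := by
  have hnil := isNilpotent_of_trace_eq_zero_of_spectrum_nonneg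
    (Algebra.lmul ℂ F (star x * x))
    (fun z hz => nonneg_of_mem_spectrum_star_mul_self x z
      (AlgHom.spectrum_apply_subset _ _ hz)) h
  have : IsNilpotent (star x * x) :=
    (IsNilpotent.map_iff (f := Algebra.lmul ℂ F) Algebra.lmul_injective).1 hnil
  exact CStarRing.star_mul_self_eq_zero_iff x |>.1
    ((IsSelfAdjoint.star_mul_self x).eq_zero_of_isNilpotent this)

-- The form is definite on pairs (x⋆, x): left multiplication by x⋆x has nonnegative spectrum, so
-- zero trace makes x⋆x nilpotent, and a self-adjoint nilpotent is zero.
variable (F) in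
theorem leftTraceForm_nondegenerate : (leftTraceForm F).Nondegenerate := by
  refine (leftTraceForm_isSymm F).isRefl.nondegenerate_iff_separatingLeft.2 fun x hx => ?_
  refine eq_zero_of_leftTrace_star_mul_self x ?_
  rw [leftTrace_mul_comm]
  exact hx (star x)

variable (F) in
/-- A separability idempotent `∑ i, a i ⊗ b i` of a finite-dimensional C⋆-algebra. -/
theorem exists_diagonal :
    ∃ (n : ℕ) (a b : Fin n → F), ∑ i, a i * b i = 1 ∧
      ∀ {V : Type*} [AddCommGroup V] [Module ℂ V] (T : F →ₗ[ℂ] F →ₗ[ℂ] V) (x : F),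
        ∑ i, T (a i) (b i * x) = ∑ i, T (x * a i) (b i) := by
  classical
  let a := Module.finBasis ℂ F
  -- For dual bases, right multiplication by x in b and left multiplication by x in a have
  -- transposed matrices; this lets x cross the tensor.
  let b := (leftTraceForm F).dualBasis (leftTraceForm_nondegenerate F) a
  have hb (x : F) (i) : b.repr x i = leftTrace F (x * a i) :=
    LinearMap.BilinForm.dualBasis_repr_apply _ a x i
  have ha (x : F) (i) : a.repr x i = leftTrace F (x * b i) := by
    have := LinearMap.BilinForm.dualBasis_dualBasis (leftTraceForm_nondegenerate F)
      (leftTraceForm_isSymm F) a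
    rw [← this, LinearMap.BilinForm.dualBasis_repr_apply]
    rfl
  refine ⟨_, a, b, ?_, ?_⟩
  -- Paired with x, the element ∑ a_i b_i gives the trace of left multiplication by x computed in
  -- the basis a, which is also the pairing of 1 with x.
  · refine sub_eq_zero.1 ((leftTraceForm_nondegenerate F).1 _ fun x => ?_)
    rw [leftTraceForm_apply, sub_mul, map_sub, sub_eq_zero, one_mul, leftTrace_mul_comm,
      Finset.mul_sum, map_sum, leftTrace_apply x, LinearMap.trace_eq_matrix_trace ℂ a, Matrix.trace]
    refine Finset.sum_congr rfl fun i _ => ?_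
    rw [Matrix.diag_apply, LinearMap.toMatrix_apply, ha, Algebra.coe_lmul_eq_mul,
      LinearMap.mul_apply', mul_assoc]
  · intro V _ _ T x
    have h1 (i) : b i * x = ∑ j, leftTrace F (b i * x * a j) • b j := by
      conv_lhs => rw [← b.sum_repr (b i * x)]
      exact Finset.sum_congr rfl fun j _ => by rw [hb]
    have h2 (j) : x * a j = ∑ i, leftTrace F (b i * x * a j) • a i := by
      conv_lhs => rw [← a.sum_repr (x * a j)]
      exact Finset.sum_congr rfl fun i _ => by rw [ha, leftTrace_mul_comm, mul_assoc]
    calc ∑ i, T (a i) (b i * x) = ∑ i, ∑ j, leftTrace F (b i * x * a j) • T (a i) (b j) :=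
          Finset.sum_congr rfl fun i _ => by conv_lhs => rw [h1 i, map_sum]; simp only [map_smul]
      _ = ∑ j, ∑ i, leftTrace F (b i * x * a j) • T (a i) (b j) := Finset.sum_comm
      _ = _ := Finset.sum_congr rfl fun j _ => by
          conv_rhs => rw [h2 j, map_sum, LinearMap.sum_apply]
          simp only [map_smul, LinearMap.smul_apply]

end FiniteDimensional

/-! ### Approximate homomorphisms and Newton's method -/

section Stability

variable {F C : Type*} [CStarAlgebra F] [CStarAlgebra C]

/-- A bounded linear map which is multiplicative and unital up to `δ`. -/
structure IsApproxHom (φ : F →L[ℂ] C) (δ : ℝ) : Prop where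
  map_one : ‖1 - φ 1‖ ≤ δ
  map_mul : ∀ x y, ‖φ (x * y) - φ x * φ y‖ ≤ δ * (‖x‖ * ‖y‖)

theorem IsApproxHom.mono {φ : F →L[ℂ] C} {δ δ' : ℝ} (h : IsApproxHom φ δ) (hδ : δ ≤ δ') :
    IsApproxHom φ δ' :=
  ⟨h.map_one.trans hδ, fun x y => (h.map_mul x y).trans (by gcongr)⟩

/-- The map `x ↦ (φ x⋆)⋆`. -/
noncomputable def starConj (φ : F →L[ℂ] C) : F →L[ℂ] C :=
  ((starL ℂ : C ≃L⋆[ℂ] C) : C →L⋆[ℂ] C).comp (φ.comp ((starL ℂ : F ≃L⋆[ℂ] F) : F →L⋆[ℂ] F))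

/-- The ⋆-preserving part of a bounded linear map. -/
noncomputable def starPart (φ : F →L[ℂ] C) : F →L[ℂ] C := (2⁻¹ : ℂ) • (φ + starConj φ)

theorem starPart_apply (φ : F →L[ℂ] C) (x : F) :
    starPart φ x = (2⁻¹ : ℂ) • (φ x + star (φ (star x))) := rfl

theorem starPart_star (φ : F →L[ℂ] C) (x : F) : starPart φ (star x) = star (starPart φ x) := by
  simp [starPart_apply, add_comm]

theorem starPart_sub_self (φ : F →L[ℂ] C) (x : F) :
    starPart φ x - φ x = (2⁻¹ : ℂ) • (star (φ (star x)) - φ x) := by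
  rw [starPart_apply]
  module

theorem norm_two_inv_smul (x : C) : ‖(2⁻¹ : ℂ) • x‖ = ‖x‖ / 2 := by
  rw [norm_smul]
  norm_num
  ring

/-- With d(x) = φ(x⋆)⋆ − φ(x), the new defect is an average of two old ones plus d(x)d(y)/4. The
failure to preserve ⋆ enters only quadratically, so symmetrising does not spoil Newton's method. -/
theorem IsApproxHom.starPart {φ : F →L[ℂ] C} {δ η : ℝ} (h : IsApproxHom φ δ)
    (hη : ∀ x, ‖star (φ (star x)) - φ x‖ ≤ η * ‖x‖) :
    IsApproxHom (starPart φ) (δ + η ^ 2 / 4) := by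
  constructor
  · have h1 : 1 - RohlinInclusion.starPart φ 1 =
        (2⁻¹ : ℂ) • ((1 - φ 1) + star (1 - φ 1)) := by
      simp only [starPart_apply, star_sub, star_one]
      module
    have := norm_add_le (1 - φ 1) (star (1 - φ 1))
    rw [norm_star] at this
    rw [h1, norm_two_inv_smul]
    have := h.map_one
    have := sq_nonneg η
    linarith
  · intro x y
    set d : F → C := fun x => star (φ (star x)) - φ x with hd
    have h1 : RohlinInclusion.starPart φ (x * y)
        - RohlinInclusion.starPart φ x * RohlinInclusion.starPart φ y =
        (2⁻¹ : ℂ) • ((φ (x * y) - φ x * φ y)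
          + star (φ (star y * star x) - φ (star y) * φ (star x)))
          + (2⁻¹ : ℂ) • ((2⁻¹ : ℂ) • (d x * d y)) := by
      simp only [starPart_apply, hd, star_mul, star_sub, mul_sub, sub_mul, mul_add, add_mul,
        smul_mul_assoc, mul_smul_comm]
      module
    have h2 := h.map_mul x y
    have h3 := h.map_mul (star y) (star x)
    rw [norm_star, norm_star, mul_comm ‖y‖] at h3
    have h4 : ‖d x * d y‖ ≤ η ^ 2 * (‖x‖ * ‖y‖) := by
      refine (norm_mul_le _ _).trans ?_
      calc ‖d x‖ * ‖d y‖ ≤ (η * ‖x‖) * (η * ‖y‖) :=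
            mul_le_mul (hη x) (hη y) (norm_nonneg _) ((norm_nonneg _).trans (hη x))
        _ = _ := by ring
    have h5 := norm_add_le (φ (x * y) - φ x * φ y)
      (star (φ (star y * star x) - φ (star y) * φ (star x)))
    rw [norm_star] at h5
    rw [h1]
    refine (norm_add_le _ _).trans ?_
    rw [norm_two_inv_smul, norm_two_inv_smul, norm_two_inv_smul]
    linarith

/-- The C⋆-identity gives ‖φ‖² ≤ ‖φ‖ + δ ≤ ‖φ‖ + 2. A bound independent of φ keeps the Newton
constants uniform. -/
theorem IsApproxHom.norm_le_two {φ : F →L[ℂ] C} {δ : ℝ} (h : IsApproxHom φ δ)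
    (hs : ∀ x, φ (star x) = star (φ x)) (hδ : δ ≤ 2) : ‖φ‖ ≤ 2 := by
  have h1 : ∀ x, ‖φ x‖ ≤ √(‖φ‖ + δ) * ‖x‖ := by
    intro x
    have h2 : ‖φ x‖ * ‖φ x‖ ≤ (‖φ‖ + δ) * ‖x‖ ^ 2 := by
      rw [← CStarRing.norm_star_mul_self, ← hs]
      have h3 := h.map_mul (star x) x
      have h4 := φ.le_opNorm (star x * x)
      rw [norm_star] at h3
      rw [CStarRing.norm_star_mul_self] at h4
      have := norm_sub_norm_le (φ (star x) * φ x) (φ (star x * x))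
      rw [norm_sub_rev] at this
      nlinarith
    rw [← Real.sqrt_sq (norm_nonneg x), ← Real.sqrt_mul' _ (sq_nonneg _)]
    exact Real.le_sqrt_of_sq_le (by rw [pow_two]; exact h2)
  have h2 : ‖φ‖ ≤ √(‖φ‖ + δ) := φ.opNorm_le_bound (Real.sqrt_nonneg _) h1
  by_contra! h3
  have h4 : ‖φ‖ ^ 2 ≤ ‖φ‖ + δ := by
    rcases le_or_gt 0 (‖φ‖ + δ) with h5 | h5
    · calc ‖φ‖ ^ 2 ≤ √(‖φ‖ + δ) ^ 2 := by gcongr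
        _ = _ := Real.sq_sqrt h5
    · rw [Real.sqrt_eq_zero_of_nonpos h5.le] at h2
      linarith
  nlinarith

/-- The correction term in Newton's method for approximate homomorphisms. -/
noncomputable def newtonTerm {n : ℕ} (a b : Fin n → F) (φ : F →L[ℂ] C) : F →L[ℂ] C :=
  ∑ i, (ContinuousLinearMap.mul ℂ C (φ (a i))).comp
    (φ.comp (ContinuousLinearMap.mul ℂ F (b i)) - (ContinuousLinearMap.mul ℂ C (φ (b i))).comp φ)

theorem newtonTerm_apply {n : ℕ} (a b : Fin n → F) (φ : F →L[ℂ] C) (x : F) :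
    newtonTerm a b φ x = ∑ i, φ (a i) * (φ (b i * x) - φ (b i) * φ x) := by
  simp [newtonTerm, mul_sub]

/-- Moving x across the diagonal cancels the part linear in the defect. Every remaining term is a
product of two small factors, as 1 − ∑ φ(a_i)φ(b_i) is itself small. -/
theorem newton_defect {n : ℕ} {a b : Fin n → F} (φ : F →L[ℂ] C)
    (hd : ∀ (T : F →ₗ[ℂ] F →ₗ[ℂ] C) (x : F),
        ∑ i, T (a i) (b i * x) = ∑ i, T (x * a i) (b i)) (x y : F) :
    (φ + newtonTerm a b φ) (x * y) - (φ + newtonTerm a b φ) x * (φ + newtonTerm a b φ) y =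
      ∑ i, (φ (x * a i) - φ x * φ (a i)) * (φ (b i * y) - φ (b i) * φ y)
      + (1 - ∑ i, φ (a i) * φ (b i)) * (φ (x * y) - φ x * φ y)
      - newtonTerm a b φ x * newtonTerm a b φ y := by
  have h1 := hd (LinearMap.mk₂ ℂ (fun u v => φ u * (φ (v * y) - φ v * φ y))
    (by intros; simp [add_mul]) (by intros; simp)
    (by intros; simp [add_mul]; noncomm_ring) (by intros; simp [← smul_sub])) x
  simp only [LinearMap.mk₂_apply] at h1
  have h2 : newtonTerm a b φ (x * y) =
      ∑ i, φ (x * a i) * (φ (b i * y) - φ (b i) * φ y)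
      - (∑ i, φ (a i) * φ (b i)) * (φ (x * y) - φ x * φ y) + newtonTerm a b φ x * φ y := by
    rw [← h1, newtonTerm_apply, newtonTerm_apply, Finset.sum_mul, Finset.sum_mul,
      ← Finset.sum_sub_distrib, ← Finset.sum_add_distrib]
    refine Finset.sum_congr rfl fun i _ => ?_
    rw [← mul_assoc (b i)]
    noncomm_ring
  have h3 : ∑ i, (φ (x * a i) - φ x * φ (a i)) * (φ (b i * y) - φ (b i) * φ y) =
      ∑ i, φ (x * a i) * (φ (b i * y) - φ (b i) * φ y) - φ x * newtonTerm a b φ y := by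
    rw [newtonTerm_apply, Finset.mul_sum, ← Finset.sum_sub_distrib]
    refine Finset.sum_congr rfl fun i _ => ?_
    noncomm_ring
  simp only [add_apply]
  rw [h2, h3]
  noncomm_ring

theorem newton_unit_defect {n : ℕ} {a b : Fin n → F} (φ : F →L[ℂ] C) :
    1 - (φ + newtonTerm a b φ) 1 = (1 - ∑ i, φ (a i) * φ (b i)) * (1 - φ 1) := by
  have : newtonTerm a b φ 1 = (∑ i, φ (a i) * φ (b i)) * (1 - φ 1) := by
    rw [newtonTerm_apply, Finset.sum_mul]
    refine Finset.sum_congr rfl fun i _ => ?_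
    rw [mul_one]
    noncomm_ring
  rw [add_apply, this]
  noncomm_ring

/-- The corrected map has defect (1 + 2N + 4N²)δ² but may fail to preserve ⋆ by 4Nδ; `starPart`
repairs this at the cost of another 4N²δ². -/
theorem IsApproxHom.newton_step {n : ℕ} {a b : Fin n → F} {φ : F →L[ℂ] C} {δ N : ℝ}
    (h : IsApproxHom φ δ) (hab : ∑ i, a i * b i = 1)
    (hd : ∀ (T : F →ₗ[ℂ] F →ₗ[ℂ] C) (x : F),
        ∑ i, T (a i) (b i * x) = ∑ i, T (x * a i) (b i))
    (hN : ∑ i, ‖a i‖ * ‖b i‖ ≤ N)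
    (hs : ∀ x, φ (star x) = star (φ x)) (hδ0 : 0 ≤ δ) (hδ : δ ≤ 2) :
    ∃ ψ : F →L[ℂ] C, IsApproxHom ψ ((1 + 4 * N + 8 * N ^ 2) * δ ^ 2) ∧
      (∀ x, ψ (star x) = star (ψ x)) ∧ ‖ψ - φ‖ ≤ (1 + 4 * N + 8 * N ^ 2) * δ := by
  have hN0 : 0 ≤ N := le_trans (by positivity) hN
  have hφ := h.norm_le_two hs hδ
  have hθ (x : F) : ‖newtonTerm a b φ x‖ ≤ 2 * N * δ * ‖x‖ := by
    rw [newtonTerm_apply]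
    calc _ ≤ ∑ i, (2 * ‖a i‖) * (δ * (‖b i‖ * ‖x‖)) := norm_sum_le_of_le _ fun i _ =>
          (norm_mul_le _ _).trans (mul_le_mul ((φ.le_opNorm _).trans (by gcongr))
            (h.map_mul _ _) (norm_nonneg _) (by positivity))
      _ = (∑ i, ‖a i‖ * ‖b i‖) * (2 * δ * ‖x‖) := by
          rw [Finset.sum_mul]; exact Finset.sum_congr rfl fun i _ => by ring
      _ ≤ N * (2 * δ * ‖x‖) := by gcongr
      _ = _ := by ring
  have hD : ‖1 - ∑ i, φ (a i) * φ (b i)‖ ≤ (1 + N) * δ := by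
    have : 1 - ∑ i, φ (a i) * φ (b i) =
        (1 - φ 1) + ∑ i, (φ (a i * b i) - φ (a i) * φ (b i)) := by
      rw [← hab, map_sum, Finset.sum_sub_distrib]
      abel
    rw [this]
    have h2 : ‖∑ i, (φ (a i * b i) - φ (a i) * φ (b i))‖ ≤ δ * N := by
      refine (norm_sum_le_of_le _ fun i _ => h.map_mul _ _).trans ?_
      rw [← Finset.mul_sum]
      gcongr
    have := norm_add_le (1 - φ 1) (∑ i, (φ (a i * b i) - φ (a i) * φ (b i)))
    have := h.map_one
    linarith
  have happ : IsApproxHom (φ + newtonTerm a b φ) ((1 + 2 * N + 4 * N ^ 2) * δ ^ 2) := by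
    constructor
    · rw [newton_unit_defect]
      calc _ ≤ ((1 + N) * δ) * δ := (norm_mul_le _ _).trans
            (mul_le_mul hD h.map_one (norm_nonneg _) (by positivity))
        _ ≤ _ := by nlinarith [mul_nonneg hN0 (sq_nonneg δ), mul_nonneg (sq_nonneg N) (sq_nonneg δ)]
    · intro x y
      rw [newton_defect φ hd]
      have h1 : ‖∑ i, (φ (x * a i) - φ x * φ (a i)) * (φ (b i * y) - φ (b i) * φ y)‖ ≤
          N * (δ ^ 2 * (‖x‖ * ‖y‖)) := by
        calc _ ≤ ∑ i, (δ * (‖x‖ * ‖a i‖)) * (δ * (‖b i‖ * ‖y‖)) :=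
              norm_sum_le_of_le _ fun i _ => (norm_mul_le _ _).trans
                (mul_le_mul (h.map_mul _ _) (h.map_mul _ _) (norm_nonneg _) (by positivity))
          _ = (∑ i, ‖a i‖ * ‖b i‖) * (δ ^ 2 * (‖x‖ * ‖y‖)) := by
              rw [Finset.sum_mul]; exact Finset.sum_congr rfl fun i _ => by ring
          _ ≤ _ := by gcongr
      have h2 : ‖(1 - ∑ i, φ (a i) * φ (b i)) * (φ (x * y) - φ x * φ y)‖ ≤
          ((1 + N) * δ) * (δ * (‖x‖ * ‖y‖)) := (norm_mul_le _ _).trans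
            (mul_le_mul hD (h.map_mul _ _) (norm_nonneg _) (by positivity))
      have h3 : ‖newtonTerm a b φ x * newtonTerm a b φ y‖ ≤
          (2 * N * δ * ‖x‖) * (2 * N * δ * ‖y‖) := (norm_mul_le _ _).trans
            (mul_le_mul (hθ _) (hθ _) (norm_nonneg _) (by positivity))
      refine (norm_sub_le _ _).trans ?_
      refine (add_le_add_left (norm_add_le _ _) _).trans ?_
      linarith
  have hη (x : F) : ‖star ((φ + newtonTerm a b φ) (star x)) - (φ + newtonTerm a b φ) x‖ ≤
      4 * N * δ * ‖x‖ := by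
    have h1 : star ((φ + newtonTerm a b φ) (star x)) - (φ + newtonTerm a b φ) x =
        star (newtonTerm a b φ (star x)) - newtonTerm a b φ x := by
      simp only [add_apply, star_add, hs, star_star]
      abel
    have h2 := hθ (star x)
    rw [norm_star] at h2
    rw [h1]
    refine (norm_sub_le _ _).trans ?_
    rw [norm_star]
    linarith [hθ x]
  refine ⟨RohlinInclusion.starPart (φ + newtonTerm a b φ), (happ.starPart hη).mono ?_,
    starPart_star _, ?_⟩
  · nlinarith [mul_nonneg hN0 (sq_nonneg δ)]
  · refine ContinuousLinearMap.opNorm_le_bound _ (by positivity) fun x => ?_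
    have h1 : (RohlinInclusion.starPart (φ + newtonTerm a b φ) - φ) x =
        (RohlinInclusion.starPart (φ + newtonTerm a b φ) x - (φ + newtonTerm a b φ) x)
          + newtonTerm a b φ x := by
      simp only [add_apply, sub_apply]
      abel
    rw [h1, starPart_sub_self]
    refine (norm_add_le _ _).trans ?_
    rw [norm_two_inv_smul]
    have h2 := hη x
    have h3 := hθ x
    have : 0 ≤ (1 + 8 * N ^ 2) * δ * ‖x‖ := by positivity
    linarith

theorem exists_starAlgHom_of_tendsto (f : ℕ → F →L[ℂ] C) (δ : ℕ → ℝ)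
    (hδ : Tendsto δ atTop (𝓝 0)) (hf : ∀ k, IsApproxHom (f k) (δ k))
    (hs : ∀ k x, f k (star x) = star (f k x)) (φ : F →L[ℂ] C) (hφ : Tendsto f atTop (𝓝 φ)) :
    ∃ ψ : F →⋆ₐ[ℂ] C, ∀ x, ψ x = φ x := by
  have ht (x : F) : Tendsto (fun k => f k x) atTop (𝓝 (φ x)) :=
    ((ContinuousLinearMap.apply ℂ C x).continuous.tendsto φ).comp hφ
  have h1 : φ 1 = 1 := by
    have h2 : Tendsto (fun k => 1 - f k 1) atTop (𝓝 0) :=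
      squeeze_zero_norm (fun k => (hf k).map_one) hδ
    exact (sub_eq_zero.1 (tendsto_nhds_unique (tendsto_const_nhds.sub (ht 1)) h2)).symm
  have hm (x y : F) : φ (x * y) = φ x * φ y := by
    have h2 : Tendsto (fun k => f k (x * y) - f k x * f k y) atTop (𝓝 0) :=
      squeeze_zero_norm (fun k => (hf k).map_mul x y)
        (by simpa using hδ.mul_const (‖x‖ * ‖y‖))
    exact sub_eq_zero.1 (tendsto_nhds_unique ((ht (x * y)).sub ((ht x).mul (ht y))) h2)
  have hst (x : F) : φ (star x) = star (φ x) :=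
    tendsto_nhds_unique (ht (star x)) (by simpa only [hs] using (ht x).star)
  exact ⟨{ AlgHom.ofLinearMap (φ : F →ₗ[ℂ] C) h1 hm with map_star' := hst }, fun x => rfl⟩

variable (F) in
/-- Finite-dimensional C⋆-algebras are stable: approximate unital ⋆-homomorphisms are near
unital ⋆-homomorphisms. -/
theorem exists_starAlgHom_near [FiniteDimensional ℂ F] {ε : ℝ} (hε : 0 < ε) :
    ∃ δ > 0, ∀ {C : Type*} [CStarAlgebra C] (φ : F →L[ℂ] C), IsApproxHom φ δ →
      (∀ x, ‖star (φ (star x)) - φ x‖ ≤ δ * ‖x‖) →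
      ∃ ψ : F →⋆ₐ[ℂ] C, ∀ x, ‖ψ x - φ x‖ ≤ ε * ‖x‖ := by
  obtain ⟨n, a, b, hab, hd⟩ := exists_diagonal F
  obtain ⟨N, hN⟩ : ∃ N, ∑ i, ‖a i‖ * ‖b i‖ = N := ⟨_, rfl⟩
  have hN0 : 0 ≤ N := hN ▸ by positivity
  set K := 1 + 4 * N + 8 * N ^ 2 with hK
  have hK1 : 1 ≤ K := by nlinarith
  -- The first bound makes the defect at least halve at each step. The second controls the total
  -- displacement: 4Kδ from the iteration and at most δ from the initial symmetrisation.
  refine ⟨min (1 / (4 * K)) (ε / (5 * K)), by positivity, fun {C} _ φ hφ hφs => ?_⟩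
  set δ := min (1 / (4 * K)) (ε / (5 * K)) with hδdef
  have hδ0 : 0 < δ := by positivity
  have hδ1 : K * δ ≤ 1 / 4 := by
    have : δ ≤ 1 / (4 * K) := min_le_left _ _
    calc K * δ ≤ K * (1 / (4 * K)) := by gcongr
      _ = 1 / 4 := by field_simp
  have hδ2 : 5 * K * δ ≤ ε := by
    have : δ ≤ ε / (5 * K) := min_le_right _ _
    calc 5 * K * δ ≤ 5 * K * (ε / (5 * K)) := by gcongr
      _ = ε := by field_simp
  have hδ3 : δ ≤ 1 / 4 := by nlinarith
  have step : ∀ (φ : F →L[ℂ] C) (δ : ℝ), ((0 ≤ δ ∧ δ ≤ 2) ∧ IsApproxHom φ δ ∧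
      (∀ x, φ (star x) = star (φ x))) → ∃ ψ : F →L[ℂ] C, IsApproxHom ψ (K * δ ^ 2) ∧
      (∀ x, ψ (star x) = star (ψ x)) ∧ ‖ψ - φ‖ ≤ K * δ :=
    fun φ δ h => h.2.1.newton_step hab hd hN.le h.2.2 h.1.1 h.1.2
  choose! next hnext using step
  -- The symmetrised start has defect at most δ + δ²/4 ≤ 2δ, whence the bounds 2δ/2^k.
  let f : ℕ → F →L[ℂ] C := fun k =>
    Nat.rec (starPart φ) (fun k g => next g (2 * δ / 2 ^ k)) k
  have hk (k : ℕ) : (1 : ℝ) ≤ 2 ^ k := one_le_pow₀ (by norm_num)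
  have hle (k : ℕ) : 2 * δ / 2 ^ k ≤ 2 * δ := div_le_self (by positivity) (hk k)
  have hf : ∀ k, IsApproxHom (f k) (2 * δ / 2 ^ k) ∧ ∀ x, f k (star x) = star (f k x) := by
    intro k
    induction k with
    | zero =>
      refine ⟨(hφ.starPart hφs).mono ?_, starPart_star φ⟩
      simp only [pow_zero, div_one]
      nlinarith
    | succ k ih =>
      have := hnext (f k) (2 * δ / 2 ^ k)
        ⟨⟨by positivity, by linarith [hle k]⟩, ih.1, ih.2⟩
      refine ⟨this.1.mono ?_, this.2.1⟩
      have h1 : K * (2 * δ / 2 ^ k) ≤ 1 / 2 := by nlinarith [hle k]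
      calc K * (2 * δ / 2 ^ k) ^ 2 = (K * (2 * δ / 2 ^ k)) * (2 * δ / 2 ^ k) := by ring
        _ ≤ 1 / 2 * (2 * δ / 2 ^ k) := by gcongr
        _ = _ := by rw [pow_succ]; field_simp
  have hdist (k : ℕ) : dist (f k) (f (k + 1)) ≤ (4 * (K * δ)) / 2 / 2 ^ k := by
    have := (hnext (f k) (2 * δ / 2 ^ k)
      ⟨⟨by positivity, by linarith [hle k]⟩, (hf k).1, (hf k).2⟩).2.2
    rw [dist_comm, dist_eq_norm]
    refine this.trans (le_of_eq ?_)
    ring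
  obtain ⟨g, hg⟩ := cauchySeq_tendsto_of_complete (cauchySeq_of_le_geometric_two hdist)
  have hfg := dist_le_of_le_geometric_two_of_tendsto₀ hdist hg
  have hlim : Tendsto (fun k : ℕ => 2 * δ / 2 ^ k) atTop (𝓝 0) :=
    tendsto_const_nhds.div_atTop (tendsto_pow_atTop_atTop_of_one_lt (by norm_num))
  obtain ⟨ψ, hψ⟩ := exists_starAlgHom_of_tendsto f _ hlim (fun k => (hf k).1)
    (fun k => (hf k).2) g hg
  refine ⟨ψ, fun x => ?_⟩
  have h1 : ‖g x - starPart φ x‖ ≤ 4 * (K * δ) * ‖x‖ := by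
    rw [← sub_apply]
    refine ((g - starPart φ).le_opNorm x).trans ?_
    gcongr
    rw [← dist_eq_norm, dist_comm]
    exact hfg
  have h2 : ‖starPart φ x - φ x‖ ≤ δ * ‖x‖ := by
    rw [starPart_sub_self, norm_two_inv_smul]
    have := hφs x
    have := norm_nonneg (star (φ (star x)) - φ x)
    linarith
  rw [hψ]
  calc ‖g x - φ x‖ ≤ ‖g x - starPart φ x‖ + ‖starPart φ x - φ x‖ :=
        norm_sub_le_norm_sub_add_norm_sub _ _ _
    _ ≤ 4 * (K * δ) * ‖x‖ + δ * ‖x‖ := add_le_add h1 h2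
    _ = (4 * (K * δ) + δ) * ‖x‖ := by ring
    _ ≤ ε * ‖x‖ := by gcongr; nlinarith

end Stability

/-! ### Unitary perturbation; locally AF and separable implies AF -/

section LocalAF

variable {B : Type*} [CStarAlgebra B]

/-- An element near `1` has a unitary polar part near `1`. -/
theorem exists_unitary_of_near_one {s : B} {η : ℝ} (hs : ‖s - 1‖ ≤ η) (hη : η ≤ 1 / 4) :
    ∃ u ∈ unitary B, ‖u - 1‖ ≤ 10 * η ∧
      ∀ x y, s * x = y * s → star s * y = x * star s → u * x = y * u := by
  have hη0 : 0 ≤ η := (norm_nonneg _).trans hs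
  set h := star s * s with hh
  have hsa : IsSelfAdjoint h := IsSelfAdjoint.star_mul_self s
  have h1 : ‖h - 1‖ ≤ 3 * η := by
    have h2 : h - 1 = star (s - 1) * (s - 1) + (s - 1) + star (s - 1) := by
      rw [star_sub, star_one, hh]
      noncomm_ring
    rw [h2]
    refine (norm_add_le _ _).trans ?_
    refine (add_le_add_left (norm_add_le _ _) _).trans ?_
    rw [CStarRing.norm_star_mul_self, norm_star]
    nlinarith [norm_nonneg (s - 1)]
  have hsub (f : ℝ → ℝ) (hf : ContinuousOn f (spectrum ℝ h)) :
      cfc (fun t => f t - 1) h = cfc f h - 1 := by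
    rw [cfc_sub f (fun _ => 1) h hf (by fun_prop), cfc_const_one ℝ h]
  have hsp : ∀ t ∈ spectrum ℝ h, |t - 1| ≤ 3 * η := by
    intro t ht
    have h2 := norm_apply_le_norm_cfc (fun t : ℝ => t - 1) h ht (by fun_prop) hsa
    rw [hsub (fun t => t) (by fun_prop), cfc_id' ℝ h] at h2
    exact h2.trans h1
  have hsp4 : ∀ t ∈ spectrum ℝ h, 1 / 4 ≤ t := by
    intro t ht
    have := (abs_le.1 (hsp t ht)).1
    linarith
  have hcont : ContinuousOn (fun t : ℝ => (√t)⁻¹) (spectrum ℝ h) := by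
    refine ContinuousOn.inv₀ (by fun_prop) fun t ht => ?_
    have := hsp4 t ht
    positivity
  -- Here r = (s⋆s)^(-1/2), and the unitary is the polar part sr.
  set r := cfc (fun t : ℝ => (√t)⁻¹) h with hr
  have hrsa : IsSelfAdjoint r := cfc_predicate _ _
  have hrr : r * r * h = 1 := by
    have h2 : r * r * h = cfc (fun t : ℝ => (√t)⁻¹ * (√t)⁻¹ * t) h := by
      rw [cfc_mul (fun t : ℝ => (√t)⁻¹ * (√t)⁻¹) (fun t => t) h (hcont.mul hcont) (by fun_prop),
        cfc_mul _ _ h hcont hcont, cfc_id' ℝ h]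
    rw [h2, ← cfc_one ℝ h]
    refine cfc_congr fun t ht => ?_
    have h3 := hsp4 t ht
    have h4 : √t * √t = t := Real.mul_self_sqrt (by linarith)
    have h5 : √t ≠ 0 := (Real.sqrt_pos.2 (by linarith)).ne'
    simp only [Pi.one_apply]
    nth_rewrite 3 [← h4]
    field_simp
  have hrcomm (x : B) (hx : Commute h x) : Commute r x := by
    refine hx.cfc_real _
  have hrh : r * h = h * r := (hrcomm h (Commute.refl h)).eq
  have hrhr : r * h * r = 1 := by rw [mul_assoc, ← hrh, ← mul_assoc, hrr]
  have hr1 : ‖r - 1‖ ≤ 6 * η := by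
    rw [hr, ← hsub _ hcont]
    refine norm_cfc_le (by positivity) fun t ht => ?_
    have h3 := hsp4 t ht
    have h4 : √t * √t = t := Real.mul_self_sqrt (by linarith)
    have h5 : 1 / 2 ≤ √t := Real.le_sqrt_of_sq_le (by linarith)
    have h6 : (√t)⁻¹ - 1 = (1 - t) / (√t * (1 + √t)) := by
      have : √t ≠ 0 := by positivity
      field_simp
      linarith
    rw [h6, Real.norm_eq_abs, abs_div, abs_sub_comm, abs_of_pos (by positivity : 0 < √t * (1 + √t)),
      div_le_iff₀ (by positivity)]
    have := hsp t ht
    nlinarith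
  -- The relation r(s⋆s)r = 1 only makes sr an isometry; invertibility of s makes it unitary.
  have hsunit : IsUnit s := by
    by_cases hB : Nontrivial B
    · have := Units.oneSub (1 - s) (by rw [norm_sub_rev]; linarith)
      have h2 := isUnit_one_sub_of_norm_lt_one (x := 1 - s) (by rw [norm_sub_rev]; linarith)
      simpa using h2
    · rw [not_nontrivial_iff_subsingleton] at hB
      exact isUnit_of_subsingleton s
  have hrunit : IsUnit r := by
    refine isUnit_iff_exists.2 ⟨h * r, ?_, ?_⟩
    · rw [← mul_assoc, hrhr]
    · rw [← hrh, hrhr]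
  have hu1 : star (s * r) * (s * r) = 1 := by
    rw [star_mul, hrsa.star_eq, mul_assoc, ← mul_assoc (star s), ← hh, ← mul_assoc, hrhr]
  refine ⟨s * r, ?_, ?_, ?_⟩
  · refine Unitary.mem_iff.2 ⟨hu1, ?_⟩
    have h2 : star (s * r) = ↑(hsunit.mul hrunit).unit⁻¹ := by
      rw [← Units.mul_left_inj (hsunit.mul hrunit).unit]
      simpa using hu1
    rw [h2]
    exact (hsunit.mul hrunit).mul_val_inv
  · have h2 : s * r - 1 = (s - 1) * (r - 1) + (s - 1) + (r - 1) := by noncomm_ring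
    rw [h2]
    refine (norm_add_le _ _).trans ?_
    refine (add_le_add_left (norm_add_le _ _) _).trans ?_
    have h3 := (norm_mul_le (s - 1) (r - 1)).trans
      (mul_le_mul hs hr1 (norm_nonneg _) hη0)
    nlinarith
  -- The two relations make x commute with s⋆s, hence with r.
  · intro x y hxy hyx
    have hc : Commute h x := by
      rw [Commute, SemiconjBy, hh, mul_assoc, hxy, ← mul_assoc, hyx, mul_assoc]
    rw [mul_assoc, (hrcomm x hc).eq, ← mul_assoc, hxy, mul_assoc]

theorem isClosed_of_finiteDimensional (G : StarSubalgebra ℂ B) [FiniteDimensional ℂ G] :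
    IsClosed (G : Set B) :=
  have : FiniteDimensional ℂ (Subalgebra.toSubmodule G.toSubalgebra) :=
    inferInstanceAs (FiniteDimensional ℂ G)
  Submodule.closed_of_finiteDimensional (Subalgebra.toSubmodule G.toSubalgebra)

/-- A ⋆-homomorphism near the inclusion is unitarily equivalent to it. -/
theorem exists_unitary_intertwiner (G : StarSubalgebra ℂ B) [FiniteDimensional ℂ G] {ε : ℝ}
    (hε : 0 < ε) : ∃ δ > 0, ∀ ψ : G →⋆ₐ[ℂ] B, (∀ x : G, ‖ψ x - x‖ ≤ δ * ‖x‖) →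
      ∃ u ∈ unitary B, ‖u - 1‖ ≤ ε ∧ ∀ x : G, u * x = ψ x * u := by
  have : IsClosed (G : Set B) := isClosed_of_finiteDimensional G
  obtain ⟨n, a, b, hab, hd⟩ := exists_diagonal G
  obtain ⟨N, hN⟩ : ∃ N, ∑ i, ‖a i‖ * ‖b i‖ = N := ⟨_, rfl⟩
  have hN0 : 0 ≤ N := hN ▸ by positivity
  refine ⟨min (1 / 4) (ε / 10) / (N + 1), by positivity, fun ψ hψ => ?_⟩
  set δ := min (1 / 4) (ε / 10) / (N + 1)
  -- The diagonal property gives sx = ψ(x)s, and ∑ a_i b_i = 1 puts s near 1. Its polar part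
  -- inherits both.
  set s : B := ∑ i, ψ (a i) * (b i : B) with hs
  have hs1 : ‖s - 1‖ ≤ min (1 / 4) (ε / 10) := by
    have h1 : s - 1 = ∑ i, (ψ (a i) - a i) * (b i : B) := by
      have h2 : (1 : B) = ∑ i, (a i : B) * (b i : B) := by
        have := congrArg (Subtype.val : G → B) hab
        simpa using this.symm
      rw [h2, hs, ← Finset.sum_sub_distrib]
      exact Finset.sum_congr rfl fun i _ => by rw [sub_mul]
    rw [h1]
    calc _ ≤ ∑ i, (δ * ‖a i‖) * ‖b i‖ := norm_sum_le_of_le _ fun i _ =>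
          (norm_mul_le _ _).trans (mul_le_mul_of_nonneg_right (hψ _) (norm_nonneg _))
      _ = δ * N := by
          rw [← hN, Finset.mul_sum]; exact Finset.sum_congr rfl fun i _ => by ring
      _ ≤ δ * (N + 1) := by gcongr; linarith
      _ = _ := by simp only [δ]; field_simp
  have hint (x : G) : s * x = ψ x * s := by
    have := hd (LinearMap.mk₂ ℂ (fun u v : G => ψ u * (v : B))
      (by intros; simp [add_mul]) (by intros; simp)
      (by intros; simp [mul_add]) (by intros; simp)) x
    simp only [LinearMap.mk₂_apply, map_mul, MulMemClass.coe_mul] at this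
    rw [hs, Finset.sum_mul, Finset.mul_sum]
    simpa only [mul_assoc] using this
  obtain ⟨u, hu, hu1, hux⟩ := exists_unitary_of_near_one hs1 (min_le_left _ _)
  refine ⟨u, hu, hu1.trans ?_, fun x => hux _ _ (hint x) ?_⟩
  · have : min (1 / 4) (ε / 10) ≤ ε / 10 := min_le_right _ _
    linarith
  · have := congrArg star (hint (star x))
    simpa [map_star] using this.symm

theorem norm_one_le_one : ‖(1 : B)‖ ≤ 1 := by
  cases subsingleton_or_nontrivial B
  · simp [Subsingleton.elim (1 : B) 0]
  · simp

/-- A linear map between finite-dimensional subalgebras which is near the inclusion is an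
approximate ⋆-homomorphism. -/
theorem isApproxHom_of_near_inclusion (G H : StarSubalgebra ℂ B) [IsClosed (G : Set B)]
    [IsClosed (H : Set B)] (φ : G →L[ℂ] H) {η : ℝ} (hη0 : 0 ≤ η) (hη : η ≤ 1)
    (hφ : ∀ x : G, ‖(φ x : B) - x‖ ≤ η * ‖x‖) :
    IsApproxHom φ (4 * η) ∧ ∀ x, ‖star (φ (star x)) - φ x‖ ≤ 2 * η * ‖x‖ := by
  refine ⟨⟨?_, fun x y => ?_⟩, fun x => ?_⟩
  · have h1 := hφ 1
    rw [norm_sub_rev] at h1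
    have h2 : ‖(1 : G)‖ ≤ 1 := norm_one_le_one
    calc ‖(1 : H) - φ 1‖ ≤ η * ‖(1 : G)‖ := h1
      _ ≤ η * 1 := by gcongr
      _ ≤ 4 * η := by linarith
  · have h1 : ((φ (x * y) - φ x * φ y : H) : B) = ((φ (x * y) : B) - (x * y : G))
        - ((φ x : B) - x) * y - x * ((φ y : B) - y) - ((φ x : B) - x) * ((φ y : B) - y) := by
      push_cast
      noncomm_ring
    have h2 : ‖(φ x : B) - x‖ * ‖(y : B)‖ ≤ η * ‖x‖ * ‖y‖ := by gcongr; exacts [hφ x, le_rfl]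
    have h3 : ‖(x : B)‖ * ‖(φ y : B) - y‖ ≤ ‖x‖ * (η * ‖y‖) := by gcongr; exacts [le_rfl, hφ y]
    have h4 : ‖(φ x : B) - x‖ * ‖(φ y : B) - y‖ ≤ (η * ‖x‖) * (1 * ‖y‖) := by
      gcongr
      · exact hφ x
      · exact (hφ y).trans (by gcongr)
    have h5 : ‖(φ (x * y) : B) - (x * y : G)‖ ≤ η * (‖x‖ * ‖y‖) :=
      (hφ _).trans (by gcongr; exact norm_mul_le _ _)
    change ‖((φ (x * y) - φ x * φ y : H) : B)‖ ≤ _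
    rw [h1]
    have h6 := norm_mul_le ((φ x : B) - x) (y : B)
    have h7 := norm_mul_le (x : B) ((φ y : B) - y)
    have h8 := norm_mul_le ((φ x : B) - x) ((φ y : B) - y)
    refine (norm_sub_le _ _).trans ?_
    refine (add_le_add_left (norm_sub_le _ _) _).trans ?_
    refine (add_le_add_left (add_le_add_left (norm_sub_le _ _) _) _).trans ?_
    linarith
  · have h1 : ((star (φ (star x)) - φ x : H) : B) =
        star ((φ (star x) : B) - (star x : G)) - ((φ x : B) - x) := by
      simp
    change ‖((star (φ (star x)) - φ x : H) : B)‖ ≤ _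
    rw [h1]
    refine (norm_sub_le _ _).trans ?_
    have h2 := hφ (star x)
    rw [norm_star] at h2
    rw [norm_star]
    linarith [hφ x]

/-- T is a basis of G. Sending it to nearby elements of H defines an approximate homomorphism G → H;
a genuine one close to it is implemented by u. It matters that δ and T are chosen before H. -/
theorem exists_unitary_conj_mem (G : StarSubalgebra ℂ B) [FiniteDimensional ℂ G] {ε : ℝ}
    (hε : 0 < ε) : ∃ δ > 0, ∃ T : Finset B, ∀ H : StarSubalgebra ℂ B, FiniteDimensional ℂ H →
      (∀ t ∈ T, ∃ h ∈ H, ‖t - h‖ < δ) →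
      ∃ u ∈ unitary B, ‖u - 1‖ ≤ ε ∧ ∀ x ∈ G, u * x * star u ∈ H := by
  classical
  have : IsClosed (G : Set B) := isClosed_of_finiteDimensional G
  obtain ⟨δ₁, hδ₁, hu⟩ := exists_unitary_intertwiner G hε
  obtain ⟨δ₂, hδ₂, hst⟩ := exists_starAlgHom_near G (half_pos hδ₁)
  let v := Module.finBasis ℂ G
  obtain ⟨c, hc, hv⟩ := v.exists_opNorm_le (F := B)
  obtain ⟨η, hη, hη1, hη2, hη3⟩ : ∃ η : ℝ, 0 < η ∧ η ≤ 1 ∧ 4 * η ≤ δ₂ ∧ η ≤ δ₁ / 2 :=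
    ⟨min 1 (min (δ₂ / 4) (δ₁ / 2)), by positivity, min_le_left _ _, by
      have : min 1 (min (δ₂ / 4) (δ₁ / 2)) ≤ δ₂ / 4 :=
        (min_le_right _ _).trans (min_le_left _ _)
      linarith, (min_le_right _ _).trans (min_le_right _ _)⟩
  refine ⟨η / c, by positivity, Finset.univ.image fun i => (v i : B), fun H _ hH => ?_⟩
  have : IsClosed (H : Set B) := isClosed_of_finiteDimensional H
  have hH' : ∀ i, ∃ h : H, ‖(v i : B) - h‖ < η / c := fun i => by
    obtain ⟨h, hh, hlt⟩ := hH (v i) (Finset.mem_image_of_mem _ (Finset.mem_univ i))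
    exact ⟨⟨h, hh⟩, hlt⟩
  choose h hh using hH'
  let φ : G →L[ℂ] H := LinearMap.toContinuousLinearMap (v.constr ℂ h)
  have hφv (i) : φ (v i) = h i := v.constr_basis ℂ h i
  let ιG : G →L[ℂ] B := LinearMap.toContinuousLinearMap G.subtype.toAlgHom.toLinearMap
  let ιH : H →L[ℂ] B := LinearMap.toContinuousLinearMap H.subtype.toAlgHom.toLinearMap
  have hκ : ‖ιH.comp φ - ιG‖ ≤ c * (η / c) := by
    refine hv (by positivity) fun i => ?_
    change ‖(φ (v i) : B) - v i‖ ≤ _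
    rw [hφv, norm_sub_rev]
    exact (hh i).le
  rw [mul_div_cancel₀ _ hc.ne'] at hκ
  have hφ (x : G) : ‖(φ x : B) - x‖ ≤ η * ‖x‖ :=
    ((ιH.comp φ - ιG).le_opNorm x).trans (by gcongr)
  obtain ⟨h1, h2⟩ := isApproxHom_of_near_inclusion G H φ hη.le hη1 hφ
  obtain ⟨ψ, hψ⟩ := hst φ (h1.mono hη2)
    (fun x => (h2 x).trans (by gcongr; linarith))
  obtain ⟨u, huu, hu1, hux⟩ := hu (H.subtype.comp ψ) fun x => by
    have h3 : ‖(ψ x : B) - φ x‖ ≤ δ₁ / 2 * ‖x‖ := hψ x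
    calc ‖(ψ x : B) - x‖ ≤ ‖(ψ x : B) - φ x‖ + ‖(φ x : B) - x‖ :=
          norm_sub_le_norm_sub_add_norm_sub _ _ _
      _ ≤ δ₁ / 2 * ‖x‖ + δ₁ / 2 * ‖x‖ := add_le_add h3 ((hφ x).trans (by gcongr))
      _ = δ₁ * ‖x‖ := by ring
  refine ⟨u, huu, hu1, fun x hx => ?_⟩
  have := hux ⟨x, hx⟩
  simp only at this
  rw [this, mul_assoc, Unitary.mul_star_self_of_mem huu, mul_one]
  exact (ψ _).2

/-- A unital C⋆-algebra in which finite sets are approximated by finite-dimensional subalgebras. -/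
def IsLocallyAF (B : Type*) [CStarAlgebra B] : Prop :=
  ∀ (S : Finset B) (ε : ℝ), 0 < ε → ∃ H : StarSubalgebra ℂ B, FiniteDimensional ℂ H ∧
    ∀ s ∈ S, ∃ h ∈ H, ‖s - h‖ < ε

/-- A subalgebra approximating both S and the test set of G contains uGu⋆ for a unitary u near 1.
Conjugating back by u⋆ captures G exactly and barely moves the approximants of S. -/
theorem IsLocallyAF.exists_extension (hB : IsLocallyAF B) (G : StarSubalgebra ℂ B)
    [FiniteDimensional ℂ G] (S : Finset B) {ε : ℝ} (hε : 0 < ε) :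
    ∃ H : StarSubalgebra ℂ B, FiniteDimensional ℂ H ∧ G ≤ H ∧ ∀ s ∈ S, ∃ h ∈ H, ‖s - h‖ < ε := by
  classical
  obtain ⟨M, hM0, hM⟩ : ∃ M : ℝ, 0 ≤ M ∧ ∀ s ∈ S, ‖s‖ ≤ M :=
    ⟨∑ s ∈ S, ‖s‖, by positivity, fun s hs =>
      Finset.single_le_sum (f := fun s => ‖s‖) (fun _ _ => norm_nonneg _) hs⟩
  obtain ⟨δ, hδ, T, hT⟩ := exists_unitary_conj_mem G (ε := ε / (4 * (M + 1))) (by positivity)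
  obtain ⟨H, hHfd, hH⟩ := hB (S ∪ T) (min δ (min 1 (ε / 4))) (by positivity)
  obtain ⟨u, hu, hu1, hux⟩ := hT H hHfd fun t ht => by
    obtain ⟨h, hh, hlt⟩ := hH t (Finset.mem_union_right _ ht)
    exact ⟨h, hh, hlt.trans_le (min_le_left _ _)⟩
  let Φ := Unitary.conjStarAlgAut ℂ B (star ⟨u, hu⟩ : unitary B)
  have hΦ (x : B) : Φ x = star u * x * u := Unitary.conjStarAlgAut_star_apply _ x
  refine ⟨H.map (Φ : B →⋆ₐ[ℂ] B), ?_, fun x hx => ?_, fun s hs => ?_⟩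
  · exact inferInstanceAs
      (FiniteDimensional ℂ ((Subalgebra.toSubmodule H.toSubalgebra).map Φ.toAlgEquiv.toLinearMap))
  · refine StarSubalgebra.mem_map.2 ⟨u * x * star u, hux x hx, ?_⟩
    change Φ _ = x
    have := Unitary.star_mul_self_of_mem hu
    rw [hΦ]
    calc star u * (u * x * star u) * u = (star u * u) * x * (star u * u) := by noncomm_ring
      _ = x := by rw [this, one_mul, mul_one]
  · obtain ⟨h, hh, hlt⟩ := hH s (Finset.mem_union_left _ hs)
    refine ⟨Φ h, StarSubalgebra.mem_map.2 ⟨h, hh, rfl⟩, ?_⟩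
    have h1 : ‖s - h‖ < ε / 4 :=
      hlt.trans_le ((min_le_right _ _).trans (min_le_right _ _))
    have h2 : ‖s - h‖ < 1 := hlt.trans_le ((min_le_right _ _).trans (min_le_left _ _))
    have h3 : ‖h‖ ≤ M + 1 := by
      have := norm_sub_norm_le h s
      rw [norm_sub_rev] at this
      linarith [hM s hs]
    have h4 : h - Φ h = star u * ((u - 1) * h - h * (u - 1)) := by
      rw [hΦ]
      have := Unitary.star_mul_self_of_mem hu
      calc h - star u * h * u = (star u * u) * h - star u * h * u := by rw [this, one_mul]
        _ = _ := by noncomm_ring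
    have h5 : ‖h - Φ h‖ ≤ ε / 2 := by
      rw [h4, CStarRing.norm_mem_unitary_mul _ (Unitary.star_mem hu)]
      refine (norm_sub_le _ _).trans ?_
      have h6 : ‖u - 1‖ * ‖h‖ ≤ ε / 4 := by
        calc ‖u - 1‖ * ‖h‖ ≤ ε / (4 * (M + 1)) * (M + 1) := by gcongr
          _ = ε / 4 := by field_simp
      have h7 := norm_mul_le (u - 1) h
      have h8 := norm_mul_le h (u - 1)
      rw [mul_comm ‖h‖] at h8
      linarith
    have h6 := norm_sub_le_norm_sub_add_norm_sub s h (Φ h)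
    linarith

/-- Iterated extension: stage n + 1 contains stage n and approximates the terms 0, …, n of a dense
sequence within 1/(n + 1). -/
theorem IsLocallyAF.isAF [TopologicalSpace.SeparableSpace B] (hB : IsLocallyAF B) : IsAF B := by
  classical
  have hstep : ∀ (G : StarSubalgebra ℂ B) (n : ℕ), FiniteDimensional ℂ G →
      ∃ H : StarSubalgebra ℂ B, FiniteDimensional ℂ H ∧ G ≤ H ∧
        ∀ k ≤ n, ∃ h ∈ H, ‖TopologicalSpace.denseSeq B k - h‖ < 1 / ((n : ℝ) + 1) := by
    intro G n hG
    obtain ⟨H, h1, h2, h3⟩ := hB.exists_extension G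
      ((Finset.range (n + 1)).image (TopologicalSpace.denseSeq B)) (ε := 1 / ((n : ℝ) + 1))
      (by positivity)
    exact ⟨H, h1, h2, fun k hk =>
      h3 _ (Finset.mem_image_of_mem _ (Finset.mem_range.2 (by omega)))⟩
  choose! next h1 h2 h3 using hstep
  obtain ⟨F, hF0, hFs⟩ : ∃ F : ℕ → StarSubalgebra ℂ B,
      F 0 = ⊥ ∧ ∀ n, F (n + 1) = next (F n) n :=
    ⟨fun k => Nat.rec ⊥ (fun k G => next G k) k, rfl, fun _ => rfl⟩
  have hfd : ∀ n : ℕ, FiniteDimensional ℂ ↥(F n) := by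
    intro n
    induction n with
    | zero =>
      rw [hF0]
      exact inferInstanceAs (FiniteDimensional ℂ (⊥ : Subalgebra ℂ B))
    | succ n ih => exact hFs n ▸ h1 (F n) n ih
  refine ⟨F, monotone_nat_of_le_succ fun n => hFs n ▸ h2 (F n) n (hfd n), hfd, ?_⟩
  refine Metric.dense_iff.2 fun x r hr => ?_
  obtain ⟨k, hk⟩ := (TopologicalSpace.denseRange_denseSeq B).exists_dist_lt x (half_pos hr)
  obtain ⟨m, hm⟩ := exists_nat_one_div_lt (half_pos hr)
  obtain ⟨h, hh, hlt⟩ := h3 (F (max k m)) (max k m) (hfd _) k (le_max_left _ _)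
  refine ⟨h, ?_, Set.mem_iUnion.2 ⟨max k m + 1, hFs _ ▸ hh⟩⟩
  have h4 : 1 / (((max k m : ℕ) : ℝ) + 1) ≤ 1 / ((m : ℝ) + 1) := by
    gcongr
    exact le_max_right _ _
  rw [Metric.mem_ball, dist_comm]
  have h5 := dist_triangle x (TopologicalSpace.denseSeq B k) h
  rw [dist_eq_norm (TopologicalSpace.denseSeq B k)] at h5
  linarith

end LocalAF

/-! ### Positive matrices over a C⋆-algebra -/

section Positivity

variable {C : Type*} [CStarAlgebra C]

theorem sq_norm_le_norm_sum_star_mul_self {ι : Type*} [Fintype ι] (x : ι → C) (k : ι) :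
    ‖x k‖ ^ 2 ≤ ‖∑ i, star (x i) * x i‖ := by
  let _ := CStarAlgebra.spectralOrder C
  have := CStarAlgebra.spectralOrderedRing C
  rw [pow_two, ← CStarRing.norm_star_mul_self]
  exact CStarAlgebra.norm_le_norm_of_nonneg_of_le (star_mul_self_nonneg _)
    (Finset.single_le_sum (f := fun i => star (x i) * x i) (fun i _ => star_mul_self_nonneg _)
      (Finset.mem_univ k))

theorem eq_zero_of_sum_star_mul_self_eq_zero {ι : Type*} [Fintype ι] {x : ι → C}
    (h : ∑ i, star (x i) * x i = 0) (k : ι) : x k = 0 := by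
  have := sq_norm_le_norm_sum_star_mul_self x k
  rw [h, norm_zero] at this
  exact norm_eq_zero.1 (pow_eq_zero_iff two_ne_zero |>.1 (le_antisymm this (sq_nonneg _)))

/-- Applied to k = M₋ and m = M₋^(1/2), for which mMm = −k², the hypothesis kills the negative part;
then M₊^(1/2) is the root. -/
theorem exists_isSelfAdjoint_mul_self_eq_of_negPart (M : C) (hM : IsSelfAdjoint M)
    (hneg : ∀ m k : C, IsSelfAdjoint m → IsSelfAdjoint k → m * M * m = -(k * k) → k = 0) :
    ∃ c : C, IsSelfAdjoint c ∧ c * c = M := by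
  set m := cfc (fun t : ℝ => √(max (-t) 0)) M with hm
  set k := cfc (fun t : ℝ => max (-t) 0) M with hk
  have hmMm : m * M * m = - (k * k) := by
    have h1 : m * M * m = cfc (fun t : ℝ => √(max (-t) 0) * t * √(max (-t) 0)) M := by
      rw [cfc_mul (fun t : ℝ => √(max (-t) 0) * t) (fun t : ℝ => √(max (-t) 0)) M
        (by fun_prop) (by fun_prop), cfc_mul (fun t : ℝ => √(max (-t) 0)) (fun t => t) M
        (by fun_prop) (by fun_prop), cfc_id' ℝ M]
    have h2 : k * k = cfc (fun t : ℝ => max (-t) 0 * max (-t) 0) M := by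
      rw [cfc_mul _ _ M (by fun_prop) (by fun_prop)]
    rw [h1, h2, ← cfc_neg]
    refine cfc_congr fun t _ => ?_
    have h3 : √(max (-t) 0) * √(max (-t) 0) = max (-t) 0 :=
      Real.mul_self_sqrt (le_max_right _ _)
    have h4 : max (-t) 0 * t = -(max (-t) 0 * max (-t) 0) := by
      rcases le_total 0 t with h | h
      · rw [max_eq_right (by linarith)]; ring
      · rw [max_eq_left (by linarith)]; ring
    rw [mul_right_comm, h3, h4]
  have hk0 : k = 0 := hneg m k (cfc_predicate _ _) (cfc_predicate _ _) hmMm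
  refine ⟨cfc (fun t : ℝ => √(max t 0)) M, cfc_predicate _ _, ?_⟩
  rw [← cfc_mul _ _ M (by fun_prop) (by fun_prop)]
  have h1 : cfc (fun t : ℝ => √(max t 0) * √(max t 0)) M =
      cfc (fun t : ℝ => t + max (-t) 0) M := by
    refine cfc_congr fun t _ => ?_
    rw [Real.mul_self_sqrt (le_max_right _ _)]
    rcases le_total 0 t with h | h
    · rw [max_eq_left h, max_eq_right (by linarith), add_zero]
    · rw [max_eq_right h, max_eq_left (by linarith), add_neg_cancel]
  rw [h1, cfc_add (a := M) (fun t : ℝ => t) (fun t => max (-t) 0) (by fun_prop) (by fun_prop),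
    ← hk, hk0, cfc_id' ℝ M, add_zero]

/-- A matrix with a positive quadratic form is a square of a self-adjoint matrix. -/
theorem exists_isSelfAdjoint_mul_self_eq {n : ℕ} (M : CStarMatrix (Fin n) (Fin n) C)
    (hM : IsSelfAdjoint M)
    (hpos : ∀ p : Fin n → C, ∃ b, ∑ i, ∑ j, star (p i) * M i j * p j = star b * b) :
    ∃ c : CStarMatrix (Fin n) (Fin n) C, IsSelfAdjoint c ∧ c * c = M := by
  let _ := CStarAlgebra.spectralOrder C
  have := CStarAlgebra.spectralOrderedRing C
  have hstar (a : CStarMatrix (Fin n) (Fin n) C) (ha : IsSelfAdjoint a) (i j) :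
      a i j = star (a j i) := by
    conv_lhs => rw [← ha.star_eq]
    rfl
  have hneg (m k : CStarMatrix (Fin n) (Fin n) C) (hm : IsSelfAdjoint m) (hk : IsSelfAdjoint k)
      (hmMm : m * M * m = -(k * k)) : k = 0 := by
    ext i j
    -- The form at the j-th column of m is the j-th diagonal entry of mMm = −k², so b⋆b + ∑ k_ij⋆
    -- k_ij = 0. Below, `Option` adjoins b as one more summand.
    obtain ⟨b, hb⟩ := hpos fun i => m i j
    have h1 : (m * M * m) j j = star b * b := by
      rw [← hb, CStarMatrix.mul_apply]
      simp only [CStarMatrix.mul_apply, Finset.sum_mul]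
      rw [Finset.sum_comm]
      refine Finset.sum_congr rfl fun i _ => Finset.sum_congr rfl fun l _ => ?_
      rw [← hstar m hm]
    have h2 : (k * k) j j = ∑ i, star (k i j) * k i j := by
      rw [CStarMatrix.mul_apply]
      refine Finset.sum_congr rfl fun i _ => ?_
      rw [← hstar k hk]
    rw [hmMm, CStarMatrix.neg_apply, h2] at h1
    have h3 : ∑ o : Option (Fin n), star (o.elim b fun i => k i j) * (o.elim b fun i => k i j)
        = 0 := by
      rw [Fintype.sum_option]
      simp only [Option.elim]
      rw [← h1, neg_add_cancel]
    exact eq_zero_of_sum_star_mul_self_eq_zero h3 (some i)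
  exact exists_isSelfAdjoint_mul_self_eq_of_negPart (C := CStarMatrix (Fin n) (Fin n) C) M hM hneg

end Positivity

/-! ### Self-adjoint quasi-bases and centrality of the index -/

section ConditionalExpectation

variable {A : Type*} [CStarAlgebra A] {P : StarSubalgebra ℂ A} {E : A →L[ℂ] A}

namespace IsConditionalExpectation

variable (hE : IsConditionalExpectation P E)
include hE

theorem map_idem (a : A) : E (E a) = E a := hE.map_of_mem _ (hE.map_mem a)

theorem map_one : E 1 = 1 := hE.map_of_mem _ (one_mem P)

theorem map_map_mul (a b : A) : E (E a * b) = E a * E b :=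
  hE.map_mul_left _ (hE.map_mem a) b

theorem map_mul_map (a b : A) : E (a * E b) = E a * E b :=
  hE.map_mul_right a _ (hE.map_mem b)

/-- Polarisation, 4h = (h + 1)² − (h − 1)², reduces this to positivity of E. -/
theorem isSelfAdjoint_map {h : A} (hh : IsSelfAdjoint h) : IsSelfAdjoint (E h) := by
  have hsq (a : A) : IsSelfAdjoint (E (star a * a)) := by
    obtain ⟨b, -, hb⟩ := hE.map_nonneg a
    rw [hb]
    exact IsSelfAdjoint.star_mul_self b
  have h1 : h = (4⁻¹ : ℝ) • (star (h + 1) * (h + 1) - star (h - 1) * (h - 1)) := by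
    have h2 : star (h + 1) * (h + 1) - star (h - 1) * (h - 1) = (4 : ℝ) • h := by
      rw [star_add, star_sub, star_one, hh.star_eq, ofNat_smul_eq_nsmul ℝ 4 h]
      noncomm_ring
    rw [h2, smul_smul]
    norm_num
  have h2 : E h = (4⁻¹ : ℝ) • (E (star (h + 1) * (h + 1)) - E (star (h - 1) * (h - 1))) := by
    conv_lhs => rw [h1]
    rw [← map_sub]
    exact map_smul (E.restrictScalars ℝ) (4⁻¹ : ℝ) _
  have h3 := (hsq (h + 1)).sub (hsq (h - 1))
  rw [h2, IsSelfAdjoint, star_smul, h3.star_eq, star_trivial]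

theorem map_star (a : A) : E (star a) = star (E a) := by
  have h1 := realPart_add_I_smul_imaginaryPart a
  have h2 : star a = (realPart a : A) - Complex.I • (imaginaryPart a : A) := by
    conv_lhs => rw [← h1]
    rw [star_add, star_smul, (realPart a).2.star_eq, (imaginaryPart a).2.star_eq]
    simp [sub_eq_add_neg]
  rw [h2]
  conv_rhs => rw [← h1]
  simp only [map_sub, map_add, map_smul, star_add, star_smul,
    (hE.isSelfAdjoint_map (realPart a).2).star_eq,
    (hE.isSelfAdjoint_map (imaginaryPart a).2).star_eq]
  simp [sub_eq_add_neg]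

/-- A conditional expectation of finite index has a quasi-basis of the form `{(w i, (w i)⋆)}`. -/
theorem exists_isQuasiBasis_star [IsClosed (P : Set A)] (hfin : HasFiniteIndex E) :
    ∃ (n : ℕ) (w : Fin n → A), IsQuasiBasis E w (fun i => star (w i)) := by
  obtain ⟨n, u, v, huv⟩ := hfin
  -- The Gram matrix of u has form p ↦ E(y⋆y) with y = ∑ u_i p_i, so it has a self-adjoint root c
  -- over P.
  let U : CStarMatrix (Fin n) (Fin n) P :=
    CStarMatrix.ofMatrix fun i j => ⟨E (star (u i) * u j), hE.map_mem _⟩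
  have hU (i j) : (U i j : A) = E (star (u i) * u j) := rfl
  have hUsa : IsSelfAdjoint U := by
    refine CStarMatrix.ext fun i j => Subtype.ext ?_
    change star (U j i : A) = U i j
    rw [hU, hU, ← hE.map_star, star_mul, star_star]
  obtain ⟨c, hc, hcU⟩ := exists_isSelfAdjoint_mul_self_eq U hUsa fun p => by
    obtain ⟨b, hb, hEb⟩ := hE.map_nonneg (∑ i, u i * p i)
    refine ⟨⟨b, hb⟩, Subtype.ext ?_⟩
    change _ = star b * b
    push_cast
    rw [← hEb, star_sum, Finset.sum_mul, map_sum]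
    refine Finset.sum_congr rfl fun i _ => ?_
    rw [Finset.mul_sum, map_sum]
    refine Finset.sum_congr rfl fun j _ => ?_
    have h1 : star (u i * (p i : A)) * (u j * (p j : A)) =
        star (p i : A) * ((star (u i) * u j) * (p j : A)) := by
      simp only [star_mul, mul_assoc]
    rw [hU, h1, hE.map_mul_left _ (star_mem (p i).2), hE.map_mul_right _ _ (p j).2, mul_assoc]
    rfl
  have hcs (i j) : star (c j i : A) = c i j := by
    have : star c i j = c i j := by rw [hc.star_eq]
    exact congrArg Subtype.val this
  have hcc (i j) : ∑ l, (c i l : A) * c l j = E (star (u i) * u j) := by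
    rw [← hU, ← hcU, CStarMatrix.mul_apply]
    push_cast
    rfl
  -- Since c² = U, the sum ∑ w_i E(w_i⋆ a) collapses to ∑ v_l⋆ E(u_l⋆ a), the adjoint of the second
  -- quasi-basis formula at a⋆.
  let w : Fin n → A := fun i => ∑ j, star (v j) * (c j i : A)
  have hw (i) : star (w i) = ∑ j, (c i j : A) * v j := by
    simp only [w, star_sum, star_mul, star_star, hcs]
  have key (a : A) : a = ∑ i, w i * E (star (w i) * a) := by
    have h1 (i) : E (star (w i) * a) = ∑ j, (c i j : A) * E (v j * a) := by
      rw [hw, Finset.sum_mul, map_sum]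
      refine Finset.sum_congr rfl fun j _ => ?_
      rw [mul_assoc, hE.map_mul_left _ (c i j).2]
    have h2 (l) : ∑ j, E (star (u l) * u j) * E (v j * a) = E (star (u l) * a) := by
      conv_rhs => rw [(huv a).1]
      rw [Finset.mul_sum, map_sum]
      refine Finset.sum_congr rfl fun j _ => ?_
      rw [← mul_assoc, hE.map_mul_map]
    symm
    calc ∑ i, w i * E (star (w i) * a)
        = ∑ i, ∑ l, ∑ j, star (v l) * (((c l i : A) * c i j) * E (v j * a)) := by
          refine Finset.sum_congr rfl fun i _ => ?_
          rw [h1]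
          simp only [w, Finset.sum_mul]
          refine Finset.sum_congr rfl fun l _ => ?_
          rw [Finset.mul_sum]
          refine Finset.sum_congr rfl fun j _ => ?_
          simp only [mul_assoc]
      _ = ∑ l, ∑ j, star (v l) * ((∑ i, (c l i : A) * c i j) * E (v j * a)) := by
          rw [Finset.sum_comm]
          refine Finset.sum_congr rfl fun l _ => ?_
          rw [Finset.sum_comm]
          refine Finset.sum_congr rfl fun j _ => ?_
          rw [Finset.sum_mul, Finset.mul_sum]
      _ = ∑ l, star (v l) * E (star (u l) * a) := by
          refine Finset.sum_congr rfl fun l _ => ?_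
          simp only [hcc]
          rw [← Finset.mul_sum, h2]
      _ = star (∑ l, E (star a * u l) * v l) := by
          rw [star_sum]
          refine Finset.sum_congr rfl fun l _ => ?_
          rw [star_mul, ← hE.map_star, star_mul, star_star]
      _ = a := by rw [← (huv (star a)).2, star_star]
  refine ⟨n, w, fun a => ⟨key a, ?_⟩⟩
  have := congrArg star (key (star a))
  rw [star_star, star_sum] at this
  refine this.trans (Finset.sum_congr rfl fun i _ => ?_)
  rw [star_mul, ← hE.map_star, star_mul, star_star, star_star]

end IsConditionalExpectation

theorem IsQuasiBasis.commute_watataniIndex {n : ℕ} {u v : Fin n → A} (h : IsQuasiBasis E u v)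
    (x : A) : Commute (watataniIndex E) x := by
  rw [watataniIndex_eq h]
  symm
  calc x * ∑ i, u i * v i = ∑ i, (∑ j, u j * E (v j * (x * u i))) * v i := by
        rw [Finset.mul_sum]
        refine Finset.sum_congr rfl fun i _ => ?_
        rw [← (h (x * u i)).1, mul_assoc]
    _ = ∑ j, u j * ∑ i, E (v j * x * u i) * v i := by
        simp only [Finset.mul_sum, Finset.sum_mul, mul_assoc]
        exact Finset.sum_comm
    _ = (∑ i, u i * v i) * x := by
        rw [Finset.sum_mul]
        refine Finset.sum_congr rfl fun j _ => ?_
        rw [← (h (v j * x)).2, mul_assoc]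

end ConditionalExpectation

/-! ### Lifting identities to the sequence algebra -/

section SequenceAlgebraLemmas

variable {A : Type*} [CStarAlgebra A]

theorem mk_eq_mk_iff {f g : ℕ →ᵇ A} :
    Ideal.Quotient.mk (cZero A) f = Ideal.Quotient.mk (cZero A) g ↔
      Tendsto (fun n => f n - g n) atTop (𝓝 0) := by
  rw [Ideal.Quotient.eq, mem_cZero]
  exact (tendsto_zero_iff_norm_tendsto_zero (f := fun n => f n - g n)).symm

/-- The embedding of `A` in `A^∞` as a ring homomorphism. -/
noncomputable def constHom (A : Type*) [CStarAlgebra A] : A →+* SeqAlgebra A where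
  toFun := constEmb
  map_one' := rfl
  map_mul' _ _ := rfl
  map_zero' := rfl
  map_add' _ _ := rfl

theorem constHom_apply (a : A) :
    constHom A a = Ideal.Quotient.mk (cZero A) (BoundedContinuousFunction.const ℕ a) := rfl

theorem star_constHom (a : A) : star (constHom A a) = constHom A (star a) := rfl

theorem constHom_injective : Function.Injective (constHom A) := by
  intro a b hab
  have := mk_eq_mk_iff.1 hab
  exact sub_eq_zero.1 (tendsto_nhds_unique tendsto_const_nhds this)

theorem commute_constHom {z : A} (hz : ∀ a, Commute z a) (x : SeqAlgebra A) :
    Commute (constHom A z) x := by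
  obtain ⟨f, rfl⟩ := Ideal.Quotient.mk_surjective x
  refine congrArg (Ideal.Quotient.mk (cZero A)) (?_ : _ = _)
  ext n
  exact hz (f n)

/-- Checked on representatives: the termwise inequality ‖f_k‖² ≤ ‖∑ f_i⋆ f_i‖ passes to the limit.
-/
theorem eq_zero_of_sum_star_mul_self_eq_zero_seq {n : ℕ} {x : Fin n → SeqAlgebra A}
    (h : ∑ i, star (x i) * x i = 0) (k : Fin n) : x k = 0 := by
  choose f hf using fun i => Ideal.Quotient.mk_surjective (x i)
  have h1 : Ideal.Quotient.mk (cZero A) (∑ i, star (f i) * f i) = 0 := by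
    rw [← h, map_sum]
    refine Finset.sum_congr rfl fun i _ => ?_
    rw [map_mul, ← star_mk, hf]
  rw [Ideal.Quotient.eq_zero_iff_mem, mem_cZero] at h1
  rw [← hf k, Ideal.Quotient.eq_zero_iff_mem, mem_cZero]
  have h2 : Tendsto (fun m => ‖f k m‖ ^ 2) atTop (𝓝 0) := by
    refine squeeze_zero (fun _ => sq_nonneg _) (fun m => ?_) h1
    have := sq_norm_le_norm_sum_star_mul_self (fun i => f i m) k
    simpa using this
  have h3 := h2.sqrt
  simpa using h3

section InducedMap

variable {P : StarSubalgebra ℂ A} {E : A →L[ℂ] A}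

theorem inducedMap_constHom (a : A) : inducedMap E (constHom A a) = constHom A (E a) := rfl

namespace IsConditionalExpectation

variable (hE : IsConditionalExpectation P E)
include hE

theorem inducedMap_map_mul (x y : SeqAlgebra A) :
    inducedMap E (inducedMap E x * y) = inducedMap E x * inducedMap E y := by
  obtain ⟨f, rfl⟩ := Ideal.Quotient.mk_surjective x
  obtain ⟨g, rfl⟩ := Ideal.Quotient.mk_surjective y
  refine congrArg (Ideal.Quotient.mk (cZero A)) (?_ : _ = _)
  ext n
  exact hE.map_map_mul (f n) (g n)

theorem inducedMap_mul_map (x y : SeqAlgebra A) :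
    inducedMap E (x * inducedMap E y) = inducedMap E x * inducedMap E y := by
  obtain ⟨f, rfl⟩ := Ideal.Quotient.mk_surjective x
  obtain ⟨g, rfl⟩ := Ideal.Quotient.mk_surjective y
  refine congrArg (Ideal.Quotient.mk (cZero A)) (?_ : _ = _)
  ext n
  exact hE.map_mul_map (f n) (g n)

theorem inducedMap_idem (x : SeqAlgebra A) :
    inducedMap E (inducedMap E x) = inducedMap E x := by
  obtain ⟨f, rfl⟩ := Ideal.Quotient.mk_surjective x
  refine congrArg (Ideal.Quotient.mk (cZero A)) (?_ : _ = _)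
  ext n
  exact hE.map_idem (f n)

theorem inducedMap_star (x : SeqAlgebra A) :
    inducedMap E (star x) = star (inducedMap E x) := by
  obtain ⟨f, rfl⟩ := Ideal.Quotient.mk_surjective x
  refine congrArg (Ideal.Quotient.mk (cZero A)) (?_ : _ = _)
  ext n
  exact hE.map_star (f n)

theorem inducedMap_mul_const {p : A} (hp : E p = p) (x : SeqAlgebra A) :
    inducedMap E (x * constHom A p) = inducedMap E x * constHom A p := by
  have h := hE.inducedMap_mul_map x (constHom A p)
  rwa [inducedMap_constHom, hp] at h

theorem inducedMap_const_mul {p : A} (hp : E p = p) (x : SeqAlgebra A) :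
    inducedMap E (constHom A p * x) = constHom A p * inducedMap E x := by
  have h := hE.inducedMap_map_mul (constHom A p) x
  rwa [inducedMap_constHom, hp] at h

end IsConditionalExpectation

theorem IsQuasiBasis.seq_left {n : ℕ} {u v : Fin n → A} (h : IsQuasiBasis E u v)
    (x : SeqAlgebra A) : ∑ i, constHom A (u i) * inducedMap E (constHom A (v i) * x) = x := by
  obtain ⟨f, rfl⟩ := Ideal.Quotient.mk_surjective x
  simp only [constHom_apply, ← map_mul, inducedMap_mk, ← map_sum]
  refine congrArg (Ideal.Quotient.mk (cZero A)) ?_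
  ext m
  simpa using (h (f m)).1.symm

theorem IsQuasiBasis.seq_right {n : ℕ} {u v : Fin n → A} (h : IsQuasiBasis E u v)
    (x : SeqAlgebra A) : ∑ i, inducedMap E (x * constHom A (u i)) * constHom A (v i) = x := by
  obtain ⟨f, rfl⟩ := Ideal.Quotient.mk_surjective x
  simp only [constHom_apply, ← map_mul, inducedMap_mk, ← map_sum]
  refine congrArg (Ideal.Quotient.mk (cZero A)) ?_
  ext m
  simpa using (h (f m)).2.symm

end InducedMap

end SequenceAlgebraLemmas

/-! ### The Rohlin projection and the asymptotic retraction -/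

section Rohlin

variable {A : Type*} [CStarAlgebra A] {P : StarSubalgebra ℂ A} {E : A →L[ℂ] A}

/-- If `E^∞ e = (Index E)⁻¹`, then every `e * a` is `e` times an element of `P^∞`. -/
theorem projection_mul_const_eq (hE : IsConditionalExpectation P E) {n : ℕ}
    {w : Fin n → A} (hw : IsQuasiBasis E w (fun i => star (w i))) {e : SeqAlgebra A}
    (he : IsStarProjection e)
    (hEe : inducedMap E e * constHom A (watataniIndex E) = 1)
    (hW : E (watataniIndex E) = watataniIndex E) (a : A) :
    e * constHom A a = constHom A (watataniIndex E) * e * inducedMap E (e * constHom A a) := by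
  set W := constHom A (watataniIndex E) with hWdef
  set κ := constHom A
  set Φ := inducedMap E
  have hWc (x : SeqAlgebra A) : W * x = x * W :=
    commute_constHom (fun a => hw.commute_watataniIndex a) x
  have hWsum : W = ∑ i, κ (w i) * κ (star (w i)) := by
    rw [hWdef, watataniIndex_eq hw, map_sum]
    exact Finset.sum_congr rfl fun i _ => map_mul _ _ _
  have hWstar : star W = W := by
    rw [hWsum, star_sum]
    refine Finset.sum_congr rfl fun i _ => ?_
    rw [star_mul, star_constHom, star_constHom, star_star]
  have hee : e * e = e := he.isIdempotentElem
  have hes : star e = e := he.isSelfAdjoint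
  have hΦW (x) : Φ (W * x) = W * Φ x := hE.inducedMap_const_mul hW x
  -- X_i is the error at a = w_i. By E^∞(e)W = 1, the cross terms in its Gram matrix combine into a
  -- single subtracted term.
  let X : Fin n → SeqAlgebra A := fun i => e * κ (w i) - W * e * Φ (e * κ (w i))
  have hXs (i) : star (X i) = κ (star (w i)) * e - W * (Φ (κ (star (w i)) * e) * e) := by
    simp only [X]
    rw [star_sub, star_mul, star_mul, star_mul, ← hE.inducedMap_star, star_mul, hes, hWstar,
      star_constHom, ← mul_assoc, hWc]
  have hΦX (i j) : Φ (star (X i) * X j) = Φ (κ (star (w i)) * (e * κ (w j)))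
      - W * (Φ (κ (star (w i)) * e) * Φ (e * κ (w j))) := by
    have h1 : star (X i) * X j = κ (star (w i)) * (e * κ (w j))
        - W * ((κ (star (w i)) * e) * Φ (e * κ (w j)))
        - W * (Φ (κ (star (w i)) * e) * (e * κ (w j)))
        + W * (W * (Φ (κ (star (w i)) * e) * (e * Φ (e * κ (w j))))) := by
      rw [hXs]
      simp only [X, sub_mul, mul_sub]
      have r1 : κ (star (w i)) * e * (e * κ (w j)) = κ (star (w i)) * (e * κ (w j)) := by
        rw [mul_assoc, ← mul_assoc e, hee]
      have r2 (y : SeqAlgebra A) (z) : y * e * (W * e * z) = W * (y * e * z) := by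
        rw [mul_assoc W e z, ← mul_assoc (y * e) W, ← hWc, mul_assoc W, ← mul_assoc (y * e) e,
          mul_assoc y e e, hee]
      have r3 : W * (Φ (κ (star (w i)) * e) * e) * (e * κ (w j)) =
          W * (Φ (κ (star (w i)) * e) * (e * κ (w j))) := by
        rw [mul_assoc W, mul_assoc _ e, ← mul_assoc e e, hee]
      rw [r1, r2, r3, mul_assoc W (_ * e), r2]
      simp only [mul_assoc]
      abel
    rw [h1, map_add, map_sub, map_sub, hΦW, hΦW, hΦW, hΦW, hE.inducedMap_mul_map,
      hE.inducedMap_map_mul, hE.inducedMap_map_mul, hE.inducedMap_mul_map]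
    have h2 : W * (Φ (κ (star (w i)) * e) * (Φ e * Φ (e * κ (w j)))) =
        Φ (κ (star (w i)) * e) * Φ (e * κ (w j)) := by
      rw [hWc, mul_assoc, mul_assoc, ← hWc (Φ (e * κ (w j))), ← mul_assoc (Φ e), hEe, one_mul]
    rw [h2]
    abel
  let H : Fin n → Fin n → SeqAlgebra A := fun k j => Φ (κ (star (w k)) * X j)
  have hXH (j) : X j = ∑ k, κ (w k) * H k j := (hw.seq_left (X j)).symm
  have hGram (i j) : Φ (star (X i) * X j) = ∑ k, star (H k i) * H k j := by
    conv_lhs => rw [hXH j, Finset.mul_sum, map_sum]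
    refine Finset.sum_congr rfl fun k _ => ?_
    rw [← mul_assoc, hE.inducedMap_mul_map, ← hE.inducedMap_star, star_mul, star_constHom,
      star_star]
  -- ∑ Z_k⋆ Z_k = ∑ w_i Φ(X_i⋆ X_j) w_j⋆, and the quasi-basis formulas collapse this to eW − We² =
  -- 0.
  let Z : Fin n → SeqAlgebra A := fun k => ∑ j, H k j * κ (star (w j))
  have hZ : ∑ k, star (Z k) * Z k = 0 := by
    have h1 : ∑ k, star (Z k) * Z k =
        ∑ i, ∑ j, κ (w i) * Φ (star (X i) * X j) * κ (star (w j)) := by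
      simp only [Z, star_sum, star_mul, hGram, Finset.mul_sum, Finset.sum_mul]
      rw [Finset.sum_comm]
      conv_rhs => rw [Finset.sum_comm]
      refine Finset.sum_congr rfl fun j _ => ?_
      rw [Finset.sum_comm]
      refine Finset.sum_congr rfl fun i _ => Finset.sum_congr rfl fun k _ => ?_
      rw [star_constHom, star_star]
      simp only [mul_assoc]
      rfl
    have h2 : ∑ i, ∑ j, κ (w i) * Φ (κ (star (w i)) * (e * κ (w j))) * κ (star (w j)) =
        e * W := by
      rw [Finset.sum_comm, hWsum, Finset.mul_sum]
      refine Finset.sum_congr rfl fun j _ => ?_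
      rw [← Finset.sum_mul, hw.seq_left, mul_assoc]
    have h3 : ∑ i, ∑ j, κ (w i) * (W * (Φ (κ (star (w i)) * e) * Φ (e * κ (w j))))
        * κ (star (w j)) = W * (e * e) := by
      calc _ = ∑ i, ∑ j, W * ((κ (w i) * Φ (κ (star (w i)) * e)) *
            (Φ (e * κ (w j)) * κ (star (w j)))) := by
            refine Finset.sum_congr rfl fun i _ => Finset.sum_congr rfl fun j _ => ?_
            rw [← mul_assoc (κ (w i)), ← hWc]
            simp only [mul_assoc]
        _ = W * ((∑ i, κ (w i) * Φ (κ (star (w i)) * e)) *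
            ∑ j, Φ (e * κ (w j)) * κ (star (w j))) := by
            rw [Finset.sum_mul_sum, Finset.mul_sum]
            simp only [Finset.mul_sum]
        _ = W * (e * e) := by rw [hw.seq_left, hw.seq_right]
    rw [h1]
    simp only [hΦX, mul_sub, sub_mul, Finset.sum_sub_distrib]
    rw [h2, h3, hee, hWc, sub_self]
  have hZ0 (k) : Z k = 0 := eq_zero_of_sum_star_mul_self_eq_zero_seq hZ k
  have hΦκ (x : SeqAlgebra A) (a b : A) : Φ (x * κ (a * E b)) = Φ (x * κ a) * κ (E b) := by
    rw [map_mul κ, ← mul_assoc]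
    exact hE.inducedMap_mul_const (hE.map_idem b) _
  have hXa (a : A) : e * κ a - W * e * Φ (e * κ a) = ∑ j, X j * κ (E (star (w j) * a)) := by
    conv_lhs => rw [(hw a).1]
    simp only [X, map_sum, Finset.mul_sum, ← Finset.sum_sub_distrib, hΦκ, sub_mul]
    refine Finset.sum_congr rfl fun j _ => ?_
    rw [map_mul, mul_assoc e, mul_assoc (W * e)]
  -- The coefficients are recovered from Z, as X_l = ∑ X_j E(w_j⋆ w_l) gives H_kl = Φ(Z_k w_l).
  have hH0 (k l) : H k l = 0 := by
    have h1 : H k l = Φ (Z k * κ (w l)) := by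
      simp only [Z, Finset.sum_mul, map_sum, mul_assoc, ← map_mul κ]
      change Φ (κ (star (w k)) * (e * κ (w l) - W * e * Φ (e * κ (w l)))) = _
      rw [hXa, Finset.mul_sum, map_sum]
      refine Finset.sum_congr rfl fun j _ => ?_
      rw [← mul_assoc, hE.inducedMap_mul_const (hE.map_idem _), hE.inducedMap_map_mul,
        inducedMap_constHom]
    rw [h1, hZ0, zero_mul, map_zero]
  refine sub_eq_zero.1 ((hXa a).trans (Finset.sum_eq_zero fun j _ => ?_))
  rw [hXH j]
  simp [hH0]

/-- E^∞(e) is fixed by E^∞, so W⁻¹ is fixed by E; the bimodule property then passes this to W. -/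
theorem IsRohlinProjection.map_watataniIndex (hE : IsConditionalExpectation P E)
    {e : SeqAlgebra A} (he : IsRohlinProjection E e) :
    E (watataniIndex E) = watataniIndex E ∧
      inducedMap E e * constHom A (watataniIndex E) = 1 := by
  obtain ⟨W, hW, hEe⟩ := he.inducedMap_eq
  have h1 : E (W⁻¹ : Aˣ) = (W⁻¹ : Aˣ) := by
    refine constHom_injective ?_
    rw [← inducedMap_constHom]
    change inducedMap E (constEmb _) = constEmb _
    rw [← hEe, hE.inducedMap_idem]
  rw [← hW]
  constructor
  · have h2 := hE.map_map_mul (W⁻¹ : Aˣ) W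
    rw [h1, Units.inv_mul, hE.map_one] at h2
    rw [← Units.mul_inv_cancel_left W (E W), ← h2, mul_one]
  · rw [hEe]
    change constHom A (W⁻¹ : Aˣ) * constHom A W = 1
    rw [← map_mul, Units.inv_mul, map_one]

/-- An inclusion with the Rohlin property has an asymptotically multiplicative approximate
retraction `A → P`. -/
theorem HasRohlinProperty.exists_asymptotic_retraction [IsClosed (P : Set A)]
    (hE : IsConditionalExpectation P E) (hR : HasRohlinProperty E) :
    ∃ (β : ℕ → A →ₗ[ℂ] P) (M : ℝ), (∀ n a, ‖β n a‖ ≤ M * ‖a‖) ∧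
      (∀ a b, Tendsto (fun n => β n (a * b) - β n a * β n b) atTop (𝓝 0)) ∧
      Tendsto (fun n => 1 - β n 1) atTop (𝓝 0) ∧
      (∀ a, Tendsto (fun n => star (β n (star a)) - β n a) atTop (𝓝 0)) ∧
      ∀ p : P, Tendsto (fun n => β n p - p) atTop (𝓝 0) := by
  obtain ⟨hfin, e, he⟩ := hR
  obtain ⟨n, w, hw⟩ := hE.exists_isQuasiBasis_star hfin
  obtain ⟨hW, hEe⟩ := he.map_watataniIndex hE
  have heq := projection_mul_const_eq hE hw he.isStarProjection hEe hW
  set W := watataniIndex E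
  set Φ := inducedMap E
  have hWc (x : SeqAlgebra A) : constHom A W * x = x * constHom A W :=
    commute_constHom (fun a => hw.commute_watataniIndex a) x
  have hWstar : star W = W := by
    simp only [W, watataniIndex_eq hw, star_sum, star_mul, star_star]
  have hec (a : A) : constHom A a * e = e * constHom A a := he.mem_centralSeq a
  obtain ⟨f, hf⟩ := Ideal.Quotient.mk_surjective e
  let B (a : A) : ℕ →ᵇ A := E.compLeftContinuousBounded ℕ
    (BoundedContinuousFunction.const ℕ W * f * BoundedContinuousFunction.const ℕ a)
  have hB (a : A) : Ideal.Quotient.mk (cZero A) (B a) =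
      constHom A W * Φ (e * constHom A a) := by
    rw [← hE.inducedMap_const_mul hW, ← hf, ← mul_assoc]
    rfl
  have heB (a : A) : e * constHom A a = e * Ideal.Quotient.mk (cZero A) (B a) := by
    rw [heq, hB, hWc e, mul_assoc]
  have hmul (a b : A) : Ideal.Quotient.mk (cZero A) (B (a * b)) =
      Ideal.Quotient.mk (cZero A) (B a * B b) := by
    have h1 : Φ (Ideal.Quotient.mk (cZero A) (B b)) = Ideal.Quotient.mk (cZero A) (B b) := by
      rw [hB, hE.inducedMap_const_mul hW, hE.inducedMap_idem]
    -- Centrality gives eab = aeb = aeB(b) = eaB(b); applying WΦ yields B(ab) = B(a)B(b).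
    have h2 : e * constHom A (a * b) =
        e * constHom A a * Φ (Ideal.Quotient.mk (cZero A) (B b)) := by
      rw [map_mul, ← mul_assoc, ← hec a, mul_assoc, heB b, h1, ← mul_assoc]
    rw [hB, h2, hE.inducedMap_mul_map, h1, ← mul_assoc, ← hB, map_mul]
  have hfix (p : P) : Ideal.Quotient.mk (cZero A) (B p) =
      Ideal.Quotient.mk (cZero A) (BoundedContinuousFunction.const ℕ (p : A)) := by
    rw [hB, hE.inducedMap_mul_const (hE.map_of_mem _ p.2), ← mul_assoc, hWc, hEe, one_mul]
    rfl
  have hstar (a : A) : Ideal.Quotient.mk (cZero A) (star (B (star a))) =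
      Ideal.Quotient.mk (cZero A) (B a) := by
    rw [← star_mk, hB, hB, star_mul, ← hE.inducedMap_star, star_mul, star_constHom,
      star_constHom, hWstar, star_star, he.isStarProjection.isSelfAdjoint.star_eq, hec, hWc]
  let β (n : ℕ) : A →ₗ[ℂ] P :=
    { toFun := fun a => ⟨E (W * f n * a), hE.map_mem _⟩
      map_add' := fun a b => Subtype.ext (by simp [mul_add])
      map_smul' := fun c a => Subtype.ext (by simp) }
  have htend (x : ℕ → P) (hx : Tendsto (fun n => (x n : A)) atTop (𝓝 0)) :
      Tendsto x atTop (𝓝 0) := tendsto_subtype_rng.2 hx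
  refine ⟨β, ‖E‖ * (‖W‖ * ‖f‖), fun n a => ?_, fun a b => htend _ (mk_eq_mk_iff.1 (hmul a b)),
    ?_, fun a => htend _ (mk_eq_mk_iff.1 (hstar a)), fun p => htend _ (mk_eq_mk_iff.1 (hfix p))⟩
  · change ‖E (W * f n * a)‖ ≤ _
    calc ‖E (W * f n * a)‖ ≤ ‖E‖ * ‖W * f n * a‖ := E.le_opNorm _
      _ ≤ ‖E‖ * ((‖W‖ * ‖f‖) * ‖a‖) := by
          gcongr
          refine (norm_mul_le _ _).trans ?_
          gcongr
          refine (norm_mul_le _ _).trans ?_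
          gcongr
          exact f.norm_coe_le_norm n
      _ = _ := by ring
  · exact htend _ (mk_eq_mk_iff.1 (hfix 1).symm)

end Rohlin

/-! ### From the asymptotic retraction to local approximation -/

section Assembly

theorem eventually_norm_le_of_tendsto_zero {F V : Type*} [NormedAddCommGroup F] [NormedSpace ℂ F]
    [FiniteDimensional ℂ F] [NormedAddCommGroup V] [NormedSpace ℂ V] (T : ℕ → F →ₗ[ℂ] V)
    (hT : ∀ x, Tendsto (fun n => T n x) atTop (𝓝 0)) {δ : ℝ} (hδ : 0 < δ) :
    ∀ᶠ n in atTop, ∀ x, ‖T n x‖ ≤ δ * ‖x‖ := by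
  let v := Module.finBasis ℂ F
  obtain ⟨c, hc, hv⟩ := v.exists_opNorm_le (F := V)
  have h1 : ∀ᶠ n in atTop, ∀ i, ‖T n (v i)‖ ≤ δ / c := by
    rw [eventually_all]
    intro i
    have := (tendsto_zero_iff_norm_tendsto_zero.1 (hT (v i))).eventually_lt_const
      (div_pos hδ hc)
    exact this.mono fun n hn => hn.le
  filter_upwards [h1] with n hn x
  have h2 : ‖LinearMap.toContinuousLinearMap (T n)‖ ≤ c * (δ / c) := hv (by positivity) hn
  rw [mul_div_cancel₀ _ hc.ne'] at h2
  exact ((LinearMap.toContinuousLinearMap (T n)).le_opNorm x).trans (by gcongr)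

/-- The one-variable case is used twice: for fixed x it gives convergence in operator norm, then
uniformity in x. -/
theorem eventually_norm_le_of_tendsto_zero₂ {F V : Type*} [NormedAddCommGroup F]
    [NormedSpace ℂ F] [FiniteDimensional ℂ F] [NormedAddCommGroup V] [NormedSpace ℂ V]
    (T : ℕ → F →ₗ[ℂ] F →ₗ[ℂ] V)
    (hT : ∀ x y, Tendsto (fun n => T n x y) atTop (𝓝 0)) {δ : ℝ} (hδ : 0 < δ) :
    ∀ᶠ n in atTop, ∀ x y, ‖T n x y‖ ≤ δ * (‖x‖ * ‖y‖) := by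
  have h1 : ∀ᶠ n in atTop, ∀ x, ‖LinearMap.toContinuousLinearMap (T n x)‖ ≤ δ * ‖x‖ := by
    refine eventually_norm_le_of_tendsto_zero
      (fun n => (LinearMap.toContinuousLinearMap (𝕜 := ℂ) (E := F) (F' := V)).toLinearMap ∘ₗ T n)
      (fun x => ?_) hδ
    refine Metric.tendsto_nhds.2 fun ε hε => ?_
    filter_upwards [eventually_norm_le_of_tendsto_zero (fun n => T n x) (hT x) (half_pos hε)]
      with n hn
    rw [dist_zero_right]
    exact (ContinuousLinearMap.opNorm_le_bound _ (half_pos hε).le hn).trans_lt (half_lt_self hε)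
  filter_upwards [h1] with n hn x y
  rw [← mul_assoc]
  exact ((LinearMap.toContinuousLinearMap (T n x)).le_opNorm y).trans (by gcongr; exact hn x)

variable {A : Type*} [CStarAlgebra A]

theorem IsAF.exists_near (hA : IsAF A) (S : Finset A) {ε : ℝ} (hε : 0 < ε) :
    ∃ H : StarSubalgebra ℂ A, FiniteDimensional ℂ H ∧ ∀ s ∈ S, ∃ h ∈ H, ‖s - h‖ < ε := by
  obtain ⟨F, hmono, hfd, hdense⟩ := hA
  have h1 : ∀ s : A, ∃ n, ∃ h ∈ F n, ‖s - h‖ < ε := fun s => by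
    obtain ⟨h, hh, hlt⟩ := hdense.exists_dist_lt s hε
    obtain ⟨n, hn⟩ := Set.mem_iUnion.1 hh
    exact ⟨n, h, hn, by rwa [← dist_eq_norm]⟩
  choose N hN using h1
  refine ⟨F (S.sup N), hfd _, fun s hs => ?_⟩
  obtain ⟨h, hh, hlt⟩ := hN s
  exact ⟨h, hmono (Finset.le_sup hs) hh, hlt⟩

theorem isLocallyAF_of_asymptotic_retraction (hA : IsAF A) (P : StarSubalgebra ℂ A)
    [IsClosed (P : Set A)] (β : ℕ → A →ₗ[ℂ] P) (M : ℝ) (hM : ∀ n a, ‖β n a‖ ≤ M * ‖a‖)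
    (hmul : ∀ a b, Tendsto (fun n => β n (a * b) - β n a * β n b) atTop (𝓝 0))
    (hone : Tendsto (fun n => 1 - β n 1) atTop (𝓝 0))
    (hstar : ∀ a, Tendsto (fun n => star (β n (star a)) - β n a) atTop (𝓝 0))
    (hfix : ∀ p : P, Tendsto (fun n => β n p - p) atTop (𝓝 0)) : IsLocallyAF P := by
  classical
  intro S ε hε
  -- The denominator |M| + 1 is positive whatever the sign of M. The error budget is ε/4 each for
  -- fixing s, replacing s by g(s), and replacing β_n by ψ.
  obtain ⟨G, hG, hSG⟩ := hA.exists_near (S.image Subtype.val)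
    (ε := ε / (4 * (|M| + 1))) (by positivity)
  have : IsClosed (G : Set A) := isClosed_of_finiteDimensional G
  have hS' : ∀ s : P, ∃ g : G, s ∈ S → ‖(s : A) - g‖ < ε / (4 * (|M| + 1)) := fun s => by
    by_cases hs : s ∈ S
    · obtain ⟨h, hh, hlt⟩ := hSG s (Finset.mem_image_of_mem _ hs)
      exact ⟨⟨h, hh⟩, fun _ => hlt⟩
    · exact ⟨0, fun h => absurd h hs⟩
  choose g hg using hS'
  set K := ∑ s ∈ S, ‖g s‖ with hK
  have hKs : ∀ s ∈ S, ‖g s‖ ≤ K := fun s hs =>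
    Finset.single_le_sum (f := fun s => ‖g s‖) (fun _ _ => norm_nonneg _) hs
  have hK0 : 0 ≤ K := by positivity
  obtain ⟨δ, hδ, hst⟩ := exists_starAlgHom_near G (ε := ε / (4 * (K + 1))) (by positivity)
  let φ (n : ℕ) : G →ₗ[ℂ] P := β n ∘ₗ G.subtype.toAlgHom.toLinearMap
  have hφ (n) (x : G) : φ n x = β n x := rfl
  have h1 : ∀ᶠ n in atTop, ∀ x y : G, ‖φ n (x * y) - φ n x * φ n y‖ ≤ δ * (‖x‖ * ‖y‖) :=
    eventually_norm_le_of_tendsto_zero₂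
      (fun n => LinearMap.mk₂ ℂ (fun x y => φ n (x * y) - φ n x * φ n y)
        (by intros; simp only [add_mul, map_add]; abel)
        (by intros; simp only [smul_mul_assoc, map_smul, smul_sub])
        (by intros; simp only [mul_add, map_add]; abel)
        (by intros; simp only [mul_smul_comm, map_smul, smul_sub]))
      (fun x y => hmul x y) hδ
  have h2 : ∀ᶠ n in atTop, ∀ x : G, ‖star (φ n (star x)) - φ n x‖ ≤ δ * ‖x‖ :=
    eventually_norm_le_of_tendsto_zero
      (fun n => ((starConj (LinearMap.toContinuousLinearMap (φ n)) -
        LinearMap.toContinuousLinearMap (φ n) : G →L[ℂ] P) : G →ₗ[ℂ] P))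
      (fun x => hstar x) hδ
  have h3 : ∀ᶠ n in atTop, ‖1 - φ n 1‖ ≤ δ :=
    ((tendsto_zero_iff_norm_tendsto_zero.1 hone).eventually_lt_const hδ).mono fun n hn => hn.le
  have h4 : ∀ᶠ n in atTop, ∀ s ∈ S, ‖β n s - s‖ < ε / 4 :=
    (Finset.eventually_all S).2 fun s _ =>
      (tendsto_zero_iff_norm_tendsto_zero.1 (hfix s)).eventually_lt_const (by positivity)
  obtain ⟨n, h1, h2, h3, h4⟩ := (h1.and (h2.and (h3.and h4))).exists
  obtain ⟨ψ, hψ⟩ := hst (LinearMap.toContinuousLinearMap (φ n)) ⟨h3, h1⟩ h2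
  refine ⟨ψ.range, ?_, fun s hs => ⟨ψ (g s), ⟨g s, rfl⟩, ?_⟩⟩
  · exact inferInstanceAs (FiniteDimensional ℂ (LinearMap.range ψ.toAlgHom.toLinearMap))
  · have h5 : ‖ψ (g s) - β n (g s)‖ ≤ ε / 4 := by
      refine (hψ (g s)).trans ?_
      calc ε / (4 * (K + 1)) * ‖g s‖ ≤ ε / (4 * (K + 1)) * (K + 1) := by
            gcongr
            linarith [hKs s hs]
        _ = ε / 4 := by field_simp
    have h6 : ‖β n s - β n (g s)‖ ≤ ε / 4 := by
      rw [← map_sub]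
      refine (hM n _).trans ?_
      calc M * ‖(s : A) - g s‖ ≤ (|M| + 1) * (ε / (4 * (|M| + 1))) := by
            gcongr
            · linarith [le_abs_self M]
            · exact (hg s hs).le
        _ = ε / 4 := by field_simp
    have h7 : s - ψ (g s) = -(β n s - s) + (β n s - β n (g s)) - (ψ (g s) - β n (g s)) := by abel
    have h8 := h4 s hs
    rw [h7]
    refine (norm_sub_le _ _).trans_lt ?_
    have h9 := norm_add_le (-(β n s - s)) (β n s - β n (g s))
    rw [norm_neg] at h9
    linarith

end Assembly

end RohlinInclusion

theorem mainTheorem3 {A : Type*} [CStarAlgebra A] [TopologicalSpace.SeparableSpace A]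
    (P : StarSubalgebra ℂ A) [IsClosed (P : Set A)] (E : A →L[ℂ] A)
    (hE : RohlinInclusion.IsConditionalExpectation P E)
    (hfin : RohlinInclusion.HasFiniteIndex E)
    (hRohlin : RohlinInclusion.HasRohlinProperty E)
    (hAF : RohlinInclusion.IsAF A) :
    RohlinInclusion.IsAF P := by
  obtain ⟨β, M, hM, hmul, hone, hstar, hfix⟩ := hRohlin.exists_asymptotic_retraction hE
  have : SecondCountableTopology A := UniformSpace.secondCountable_of_separable A
  have : TopologicalSpace.SeparableSpace P :=
    inferInstanceAs (TopologicalSpace.SeparableSpace (P : Set A))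
  exact (RohlinInclusion.isLocallyAF_of_asymptotic_retraction hAF P β M hM hmul hone hstar
    hfix).isAF
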